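/- **Setting.** Let $k,d\ge 1$ and write $x\in\mathbb R^{kd}$ as $k$ consecutive patches $x=(x^{(1)},\dots,x^{(k)})$, $x^{(i)}\in\mathbb R^d$. For a unit vector $w^\star\in\mathbb R^d$ and $\sigma>0$, let $\mu_i\in\mathbb R^{kd}$ have $i$-th patch $w^\star$ and all other patches zero. The distribution $\mathrm{DSD}$ on $\mathbb R^{kd}\times\mathbb R$ is that of $(x,y)$ where $i\sim\mathrm{Unif}\{1,\dots,k\}$ and $y\sim\mathrm{Unif}\{-1,1\}$ are independent and $x\mid(y,i)\sim\mathcal N(y\mu_i,\sigma^2 I_{kd})$. The weight-shared CNN with parameter $v=(w,b)\in\mathcal W=\mathbb R^d\times[0,\infty)$ is $\mathcal M[v](x)=\sum_{i=1}^k\phi_b(w^{\top}x^{(i)})$, where $\phi_b(t)=\max(t-b,0)-\max(-t-b,0)$. For a list $S$ of $m$ labelled samples let $\ell_S(w,b)=\frac1m\sum_{(x,y)\in S}\bigl(y-\mathcal M[w,b](x)\bigr)^2$. *Two-step projected gradient descent* with initialization distribution $W$ on $\mathcal W$, step sizes $\eta_1,\eta_2>0$ and biases $b_1,b_2\ge 0$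 draws $(w^0,b^0)\sim W$, splits the $n$ samples into batches $S_1,S_2$ of $\lfloor n/2\rfloor$ samples each (dropping the last sample if $n$ is odd), and for $t=1,2$ puts $$\hat w^t=w^{t-1}-\eta_t\nabla_w\ell_{S_t}(w^{t-1},b^{t-1}),\qquad w^t=\hat w^t/\|\hat w^t\|,\qquad b^t=b_t$$ (conventions: $b^1=b_1$, $b^2=b_2$; $0/\|0\|=0$; $\nabla_w\ell=0$ at points of non-differentiability; $\ell_S=0$ if $S$ is empty). It returns $\mathcal M[w^2,b^2]$. An iterative algorithm with model $\mathcal M$, initialization distribution $W$ and update functions $F^t(v,S)$ on $\mathcal W\subseteq\mathbb R^p$ is $\mathcal U$-equivariant, for a set $\mathcal U$ of orthogonal maps of the input space, if there is a set $\mathcal V$ of orthogonal maps of $\mathbb R^p$ preserving $\mathcal W$ such that (i) for every $U\in\mathcal U$ there is $V\in\mathcal V$ with $\mathcal M[v](x)=\mathcal M[Vv](Ux)$ and $V F^t(v,(x_j,y_j)_j)=F^t(Vv,(Ux_j,y_j)_j)$ for all $x$, all data sets, all $t$ and all $v\in\mathcal W$; and (ii) if $v\sim W$ then $Vv\sim W$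 for every $V\in\mathcal V$. Let $\mathcal U$ be the group generated by the maps $x\mapsto(Qx^{(1)},\dots,Qx^{(k)})$, $Q\in O(d)$, and the permutations of the $k$ patches. For a family of algorithms indexed by the number $n$ of samples, the $\delta$-sample complexity $n_\delta$ is the least $n$ for which the expectation, over $n$ i.i.d. samples from $\mathrm{DSD}$ and the independent initialization, of the risk $R(f)=\mathbb E_{(x,y)\sim\mathrm{DSD}}(f(x)-y)^2$ of the returned function $f$ is at most $\delta$ ($n_\delta=\infty$ if there is none). **Theorem.** There are universal constants $C>0$ and $K_0\in\mathbb N$ such that for all $k,d\ge1$ there are an initialization distribution $W$ on $\mathcal W$, step sizes $\eta_1,\eta_2>0$ and biases $b_1,b_2\ge0$, depending only on $k,d$, such that the two-step projected gradient descent for the weight-shared CNN with these parameters is $\mathcal U$-equivariant for every number $n$ of samples, and, if $k,d\ge K_0$, then for every $0<\sigma\le\dfrac{1}{100\sqrt{k\,\ln(kd)^3}}$ and every unit vector $w^\star\in\mathbb R^d$ its sample complexity for $\delta=2.5\cdot10^{-3}$ satisfies $$n_\delta\le\max\bigl(C\,\sigma^2(k+d)\ln(kd),\,10\bigr).$$ 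-/

import Mathlib

open MeasureTheory ProbabilityTheory
open scoped ENNReal RealInnerProductSpace

namespace DSD

noncomputable section

/-! ### Iterative randomized algorithms, risk, sample complexity, equivariance -/

/-- An iterative randomized algorithm on `n` labelled samples `(x, y) ∈ X × ℝ`: a parametric model
`model : G → X → ℝ` with parameter set `paramSet ⊆ G`, an initialization distribution `init`
carried by `paramSet`, and update functions `update 0, …, update (steps - 1)`, each of which maps
the current parameter and the data set to a new parameter in `paramSet`. -/
structure IterativeAlgorithm (X G : Type*) [MeasurableSpace X] [MeasurableSpace G] (n : ℕ) where
  model : G → X → ℝ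
  paramSet : Set G
  init : Measure G
  steps : ℕ
  update : Fin steps → G → (Fin n → X × ℝ) → G
  isProbabilityMeasure_init : IsProbabilityMeasure init
  init_mem : ∀ᵐ w ∂init, w ∈ paramSet
  update_mem : ∀ t w S, w ∈ paramSet → update t w S ∈ paramSet
  measurable_model : Measurable (Function.uncurry model)
  measurable_update : ∀ t, Measurable (Function.uncurry (update t))

namespace IterativeAlgorithm

variable {X G : Type*} [MeasurableSpace X] [MeasurableSpace G] {n : ℕ}

/-- The parameter `update (steps - 1) (⋯ (update 0 w₀ S) ⋯) S` reached from `w₀` on the data `S`. -/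
def finalParam (A : IterativeAlgorithm X G n) (S : Fin n → X × ℝ) (w₀ : G) : G :=
  Fin.foldl A.steps (fun w t => A.update t w S) w₀

/-- The function returned by the algorithm. -/
def output (A : IterativeAlgorithm X G n) (S : Fin n → X × ℝ) (w₀ : G) : X → ℝ :=
  A.model (A.finalParam S w₀)

end IterativeAlgorithm

/-- The risk of `f` under `P` for the squared loss. -/
def risk {X : Type*} [MeasurableSpace X] (f : X → ℝ) (P : Measure (X × ℝ)) : ℝ≥0∞ :=
  ∫⁻ z, ENNReal.ofReal ((f z.1 - z.2) ^ 2) ∂P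

/-- The expected risk, over `n` i.i.d. samples from `P` and an independent random initialization. -/
def expectedRisk {X G : Type*} [MeasurableSpace X] [MeasurableSpace G] {n : ℕ}
    (A : IterativeAlgorithm X G n) (P : Measure (X × ℝ)) : ℝ≥0∞ :=
  ∫⁻ S, ∫⁻ w₀, risk (A.output S w₀) P ∂A.init ∂(Measure.pi fun _ : Fin n => P)

/-- The `δ`-sample complexity of a family `(A n)ₙ` of algorithms: the least number `n` of samples
with which the expected risk is at most `δ` (and `⊤` if there is none). -/
def sampleComplexity {X G : Type*} [MeasurableSpace X] [MeasurableSpace G]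
    (A : ∀ n, IterativeAlgorithm X G n) (P : Measure (X × ℝ)) (δ : ℝ) : ℕ∞ :=
  ⨅ (n : ℕ) (_ : expectedRisk (A n) P ≤ ENNReal.ofReal δ), (n : ℕ∞)

/-- `𝒰`-equivariance of an iterative algorithm, for a set `𝒰` of orthogonal maps of the input
space; `𝒱` is a set of orthogonal maps of the ambient space of the parameters. -/
def IsEquivariant {X G : Type*}
    [NormedAddCommGroup X] [InnerProductSpace ℝ X] [MeasurableSpace X]
    [NormedAddCommGroup G] [InnerProductSpace ℝ G] [MeasurableSpace G] {n : ℕ}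
    (A : IterativeAlgorithm X G n) (𝒰 : Set (X ≃ₗᵢ[ℝ] X)) : Prop :=
  ∃ 𝒱 : Set (G ≃ₗᵢ[ℝ] G),
    (∀ V ∈ 𝒱, ∀ w ∈ A.paramSet, V w ∈ A.paramSet) ∧
    (∀ U ∈ 𝒰, ∃ V ∈ 𝒱,
      (∀ x, ∀ w ∈ A.paramSet, A.model w x = A.model (V w) (U x)) ∧
      (∀ S : Fin n → X × ℝ, ∀ t : Fin A.steps, ∀ w ∈ A.paramSet,
        V (A.update t w S) = A.update t (V w) (fun j => (U (S j).1, (S j).2)))) ∧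
    (∀ V ∈ 𝒱, A.init.map V = A.init)

/-! ### The data distribution -/

/-- A patch, i.e. a vector of `ℝᵈ` with its Euclidean norm. -/
abbrev Patch (d : ℕ) := EuclideanSpace ℝ (Fin d)

/-- The input space `ℝᵏᵈ` with its Euclidean norm, as `k` consecutive patches; `x i` is the `i`-th
patch of `x`. -/
abbrev Input (k d : ℕ) := PiLp 2 (fun _ : Fin k => Patch d)

/-- The mean vector whose `i`-th patch is `w` and whose other patches vanish. -/
def signal {k d : ℕ} (w : Patch d) (i : Fin k) : Input k d :=
  WithLp.toLp 2 (Pi.single i w)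

/-- The Dynamic Signal Distribution on `ℝᵏᵈ × ℝ`: draw a patch index `i` and a label `y ∈ {1, -1}`
uniformly and independently, then `x ∼ N(y μᵢ, σ² I)` where `μᵢ` is `w` placed in patch `i`. -/
def dsd (k d : ℕ) (w : Patch d) (σ : ℝ) : Measure (Input k d × ℝ) :=
  (k : ℝ≥0∞)⁻¹ • ∑ i : Fin k, (2 : ℝ≥0∞)⁻¹ • ∑ y ∈ ({1, -1} : Finset ℝ),
    (stdGaussian (Input k d)).map (fun g => (y • signal w i + σ • g, y))

/-! ### The group acting on the inputs -/

/-- The orthogonal maps that apply one orthogonal map of `ℝᵈ` to every patch. -/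
def sharedOrthogonal (k d : ℕ) : Set (Input k d ≃ₗᵢ[ℝ] Input k d) :=
  {U | ∃ Q : Patch d ≃ₗᵢ[ℝ] Patch d, ∀ x i, (U x) i = Q (x i)}

/-- The orthogonal maps that permute the patches. -/
def patchPermutations (k d : ℕ) : Set (Input k d ≃ₗᵢ[ℝ] Input k d) :=
  {U | ∃ π : Equiv.Perm (Fin k), ∀ x i, (U x) (π i) = x i}

/-- The group generated by the two families of maps. -/
def cnnGroup (k d : ℕ) : Subgroup (Input k d ≃ₗᵢ[ℝ] Input k d) :=
  Subgroup.closure (sharedOrthogonal k d ∪ patchPermutations k d)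

/-! ### The convolutional network and its training -/

/-- The ambient space `ℝᵈ × ℝ` (with the Euclidean norm of `ℝᵈ⁺¹`) of the parameters `(w, b)`. -/
abbrev Param (d : ℕ) := WithLp 2 (Patch d × ℝ)

/-- The parameter set `ℝᵈ × ℝ₊`. -/
def cnnParamSet (d : ℕ) : Set (Param d) := {v | 0 ≤ v.snd}

/-- The rectified linear unit. -/
def relu (x : ℝ) : ℝ := max x 0

/-- The soft-thresholding activation `φ_b`. -/
def lsa (b x : ℝ) : ℝ := relu (x - b) - relu (-x - b)

/-- The weight-shared one-hidden-layer network `x ↦ ∑ i, φ_b (wᵀ x⁽ⁱ⁾)`. -/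
def cnn {k d : ℕ} (v : Param d) (x : Input k d) : ℝ :=
  ∑ i, lsa v.snd ⟪v.fst, x i⟫

/-- The empirical squared loss of the network with weight `w` and bias `b` on `m` samples. -/
def empiricalLoss {k d m : ℕ} (b : ℝ) (S : Fin m → Input k d × ℝ) (w : Patch d) : ℝ :=
  (1 / (m : ℝ)) * ∑ j, ((S j).2 - cnn (WithLp.toLp 2 (w, b)) (S j).1) ^ 2

/-- The `t`-th of the two batches of `⌊n / 2⌋` samples each (a last odd sample is not used). -/
def batch {α : Type*} {n : ℕ} (S : Fin n → α) (t : Fin 2) : Fin (n / 2) → α :=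
  fun j => S ⟨t * (n / 2) + j, by have := j.2; have := t.2; interval_cases (t : ℕ) <;> omega⟩

/-- One step of projected gradient descent on the weight, with step size `η`: a gradient step for
the empirical loss at the current weight and bias, followed by normalization of the weight. The
new bias is `b'`. -/
def projectedStep {k d m : ℕ} (η b' : ℝ) (v : Param d) (S : Fin m → Input k d × ℝ) : Param d :=
  WithLp.toLp 2
    (NormedSpace.normalize (v.fst - η • gradient (empiricalLoss v.snd S) v.fst), b')

lemma continuous_cnn {k d : ℕ} :
    Continuous (fun p : Param d × Input k d => cnn p.1 p.2) := by
  unfold cnn lsa relu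
  fun_prop

lemma continuous_empiricalLoss {k d m : ℕ} :
    Continuous (Function.uncurry fun (p : ℝ × (Fin m → Input k d × ℝ)) (w : Patch d) =>
      empiricalLoss p.1 p.2 w) := by
  unfold empiricalLoss cnn lsa relu Function.uncurry
  fun_prop

lemma measurable_gradient_empiricalLoss {k d m : ℕ} :
    Measurable (fun q : (ℝ × (Fin m → Input k d × ℝ)) × Patch d =>
      gradient (empiricalLoss q.1.1 q.1.2) q.2) := by
  have hfd := measurable_fderiv_with_param ℝ
    (continuous_empiricalLoss (k := k) (d := d) (m := m))
  have hD : Measurable (InnerProductSpace.toDual ℝ (Patch d)).symm :=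
    (InnerProductSpace.toDual ℝ (Patch d)).symm.continuous.measurable
  have h := hD.comp hfd
  exact h

lemma measurable_projectedStep {k d m : ℕ} (η b' : ℝ) :
    Measurable (fun p : Param d × (Fin m → Input k d × ℝ) => projectedStep η b' p.1 p.2) := by
  have hfst : Measurable (fun p : Param d × (Fin m → Input k d × ℝ) => p.1.fst) := by
    apply Continuous.measurable; fun_prop
  have hsnd : Measurable (fun p : Param d × (Fin m → Input k d × ℝ) => p.1.snd) := by
    apply Continuous.measurable; fun_prop
  have hq : Measurable (fun p : Param d × (Fin m → Input k d × ℝ) =>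
      ((p.1.snd, p.2), p.1.fst)) := (hsnd.prodMk measurable_snd).prodMk hfst
  have hgrad : Measurable (fun p : Param d × (Fin m → Input k d × ℝ) =>
      gradient (empiricalLoss p.1.snd p.2) p.1.fst) := by
    have h := (measurable_gradient_empiricalLoss (k := k) (d := d) (m := m)).comp hq
    exact h
  have hu : Measurable (fun p : Param d × (Fin m → Input k d × ℝ) =>
      p.1.fst - η • gradient (empiricalLoss p.1.snd p.2) p.1.fst) :=
    hfst.sub (hgrad.const_smul η)
  have hn : Measurable (fun p : Param d × (Fin m → Input k d × ℝ) =>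
      ‖p.1.fst - η • gradient (empiricalLoss p.1.snd p.2) p.1.fst‖⁻¹ •
        (p.1.fst - η • gradient (empiricalLoss p.1.snd p.2) p.1.fst)) :=
    hu.norm.inv.smul hu
  have h2 : Measurable (fun p : Param d × (Fin m → Input k d × ℝ) =>
      (‖p.1.fst - η • gradient (empiricalLoss p.1.snd p.2) p.1.fst‖⁻¹ •
        (p.1.fst - η • gradient (empiricalLoss p.1.snd p.2) p.1.fst), b')) :=
    hn.prodMk measurable_const
  have h3 := (WithLp.measurable_toLp 2 (Patch d × ℝ)).comp h2
  exact h3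

lemma measurable_projectedStep_batch {k d n : ℕ} (η b' : ℝ) (t : Fin 2) :
    Measurable (Function.uncurry fun (v : Param d) (S : Fin n → Input k d × ℝ) =>
      projectedStep η b' v (batch S t)) := by
  have hb : Measurable (fun S : Fin n → Input k d × ℝ => batch S t) :=
    measurable_pi_lambda _ fun j => measurable_pi_apply _
  have h1 := measurable_projectedStep (k := k) (d := d) (m := n / 2) η b'
  have h2 : Measurable (fun p : Param d × (Fin n → Input k d × ℝ) => (p.1, batch p.2 t)) :=
    measurable_fst.prodMk (hb.comp measurable_snd)
  have h3 := h1.comp h2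
  exact h3

/-- Two-step projected gradient descent for the weight-shared network, with initialization
distribution `W`; step `t` uses the `t`-th batch and the step size `η t`, and sets the bias to
`b t`. -/
def cnnPGD (k d : ℕ) (W : Measure (Param d)) (hW : IsProbabilityMeasure W)
    (hW' : ∀ᵐ v ∂W, v ∈ cnnParamSet d) (η b : Fin 2 → ℝ) (hb : ∀ t, 0 ≤ b t) (n : ℕ) :
    IterativeAlgorithm (Input k d) (Param d) n where
  model := cnn
  paramSet := cnnParamSet d
  init := W
  steps := 2
  update t v S := projectedStep (η t) (b t) v (batch S t)
  isProbabilityMeasure_init := hW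
  init_mem := hW'
  update_mem t _ _ _ := hb t
  measurable_model := continuous_cnn.measurable
  measurable_update t := measurable_projectedStep_batch (η t) (b t) t

end

end DSD

/-! Two gradient steps suffice because each has a simple closed form. Take the Dirac mass at the
zero parameter as initialization. Linear maps fix it, so equivariance reduces to the symmetry of the
loss: an element of the group acts as one `Q` on all patches followed by a permutation, and moving
the weight by `Q` compensates (`projectedStep_map`).

At bias zero the activation is the identity, so the first gradient at the origin is, up to a factor,
the average of label times sum of patches, that is `wStar` plus noise summed over all `k` patches
(`projectedStep_first`). This noise has squared length of order `σ² k d / m`, a small multiple of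
`k`, so after normalization the weight has correlation at least `2 / √k` with `wStar`
(`measure_first_bad_le`).

The bias `b = 1 / √k` then separates signal from noise: with high probability every noise response
is below `b`, while the response of the signal patch exceeds `2b - b` (`measure_active_noise_le`).
On that event only signal patches enter the second gradient (`projectedStep_second`). The negative
half-gradient has mean `ρ wStar - σ² w` with `ρ = 1 - ⟪w, wStar⟫ + b ≥ b`, and deviates from it by
less than `ρ / 200` outside a small event (`measure_gradient_deviation_le`). A step of order `1 / b`
makes the `wStar` component dominate the old unit weight, so the new correlation is at least `49/50`
(`inner_second_weight_ge`).

The last bias is zero, so the returned network is linear and its risk is explicit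
(`risk_linear_le`): at most `1/1000` on the good event and at most `5` always. The bad event has
probability at most `2/10^4`, since the batches are independent (`measure_bad_le`), so the expected
risk is at most `2/1000 < 1/400`. `exists_sample_size` supplies a sample size large enough for
concentration yet small enough for the union bound over noise patches. -/

namespace DSD

/-! ### The activation and the gradient of the empirical loss. -/

section Network

variable {k d m : ℕ}

lemma lsa_zero_left (t : ℝ) : lsa 0 t = t := by
  unfold lsa relu
  rcases le_total 0 t with h | h
  · rw [max_eq_left (by linarith), max_eq_right (by linarith)]; ring
  · rw [max_eq_right (by linarith), max_eq_left (by linarith)]; ring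

lemma lsa_eq_zero {b t : ℝ} (h : |t| ≤ b) : lsa b t = 0 := by
  obtain ⟨h1, h2⟩ := abs_le.mp h
  unfold lsa relu
  rw [max_eq_right (by linarith), max_eq_right (by linarith), sub_zero]

lemma lsa_eq_sub {b t : ℝ} (hb : 0 ≤ b) (h : b ≤ t) : lsa b t = t - b := by
  unfold lsa relu
  rw [max_eq_left (by linarith), max_eq_right (by linarith), sub_zero]

lemma lsa_neg (b t : ℝ) : lsa b (-t) = -lsa b t := by
  unfold lsa
  rw [neg_neg, neg_sub]

lemma hasDerivAt_lsa_zero (t : ℝ) : HasDerivAt (lsa 0) 1 t := by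
  have h : lsa 0 = id := funext lsa_zero_left
  rw [h]
  exact hasDerivAt_id t

lemma hasDerivAt_lsa_of_abs_lt {b t : ℝ} (h : |t| < b) : HasDerivAt (lsa b) 0 t := by
  refine (hasDerivAt_const t (0 : ℝ)).congr_of_eventuallyEq ?_
  filter_upwards [(continuous_abs.tendsto t).eventually (gt_mem_nhds h)] with s hs
  exact lsa_eq_zero hs.le

lemma hasDerivAt_lsa_of_lt {b t : ℝ} (hb : 0 ≤ b) (h : b < t) : HasDerivAt (lsa b) 1 t := by
  refine ((hasDerivAt_id t).sub_const b).congr_of_eventuallyEq ?_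
  filter_upwards [lt_mem_nhds h] with s hs
  exact lsa_eq_sub hb hs.le

lemma hasDerivAt_lsa_neg {b t c : ℝ} (h : HasDerivAt (lsa b) c t) :
    HasDerivAt (lsa b) c (-t) := by
  have h1 : HasDerivAt (fun s => -lsa b (-s)) c (-t) := by
    have h2 : HasDerivAt (lsa b) c (- -t) := by rwa [neg_neg]
    have h3 := (h2.scomp (-t) (hasDerivAt_neg (-t))).neg
    rw [smul_eq_mul, neg_one_mul, neg_neg] at h3
    exact h3
  refine h1.congr_of_eventuallyEq (Filter.Eventually.of_forall fun s => ?_)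
  simp [lsa_neg]

lemma cnn_toLp (w : Patch d) (b : ℝ) (x : Input k d) :
    cnn (WithLp.toLp 2 (w, b)) x = ∑ i, lsa b ⟪w, x i⟫ := rfl

lemma hasFDerivAt_cnn {b : ℝ} {w : Patch d} {x : Input k d} {c : Fin k → ℝ}
    (h : ∀ i, HasDerivAt (lsa b) (c i) ⟪w, x i⟫) :
    HasFDerivAt (fun w' : Patch d => cnn (WithLp.toLp 2 (w', b)) x)
      (InnerProductSpace.toDual ℝ (Patch d) (∑ i, c i • x i)) w := by
  have h1 : ∀ i ∈ Finset.univ, HasFDerivAt (fun w' : Patch d => lsa b ⟪w', x i⟫)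
      (c i • innerSL ℝ (x i)) w := by
    intro i _
    have h2 : HasFDerivAt (fun w' : Patch d => ⟪w', x i⟫) (innerSL ℝ (x i)) w := by
      have h3 := (innerSL ℝ (x i)).hasFDerivAt (x := w)
      refine h3.congr_of_eventuallyEq (Filter.Eventually.of_forall fun v => ?_)
      exact real_inner_comm _ _
    exact (h i).comp_hasFDerivAt w h2
  have h4 := HasFDerivAt.fun_sum h1
  have h5 : InnerProductSpace.toDual ℝ (Patch d) (∑ i, c i • x i)
      = ∑ i, c i • innerSL ℝ (x i) := by
    ext v
    simp
  rw [h5]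
  exact h4

/-- The slopes `c` are left abstract so that one formula serves both steps: all slopes are `1` in
the first, and they indicate the signal patch in the second. The hypothesis keeps every response off
the kinks. -/
lemma gradient_empiricalLoss {b : ℝ} {w : Patch d} {S : Fin m → Input k d × ℝ}
    {c : Fin m → Fin k → ℝ} (h : ∀ j i, HasDerivAt (lsa b) (c j i) ⟪w, (S j).1 i⟫) :
    gradient (empiricalLoss b S) w = -((2 / (m : ℝ)) •
      ∑ j, ((S j).2 - cnn (WithLp.toLp 2 (w, b)) (S j).1) • ∑ i, c j i • (S j).1 i) := by
  have h1 : ∀ j ∈ Finset.univ, HasFDerivAt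
      (fun w' : Patch d => ((S j).2 - cnn (WithLp.toLp 2 (w', b)) (S j).1) ^ 2) _ w :=
    fun j _ => ((hasFDerivAt_cnn (h j)).const_sub (S j).2).pow 2
  have h2 := (HasFDerivAt.fun_sum h1).const_mul (1 / (m : ℝ))
  apply HasGradientAt.gradient
  rw [hasGradientAt_iff_hasFDerivAt]
  refine HasFDerivAt.congr_fderiv h2 ?_
  ext v
  simp only [one_div, Nat.add_one_sub_one, pow_one, nsmul_eq_mul, Nat.cast_ofNat, smul_neg,
    Finset.sum_neg_distrib, neg_apply, smul_apply,
    sum_apply, smul_eq_mul, map_neg, InnerProductSpace.toDual_apply_apply,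
    real_inner_smul_left, sum_inner, Finset.mul_sum, neg_inj]
  refine Finset.sum_congr rfl fun j _ => Finset.sum_congr rfl fun i _ => ?_
  ring

end Network

/-! ### Equivariance under the group of inputs. -/

section Equivariance

variable {k d m : ℕ}

lemma exists_of_mem_cnnGroup {U : Input k d ≃ₗᵢ[ℝ] Input k d} (hU : U ∈ cnnGroup k d) :
    ∃ (Q : Patch d ≃ₗᵢ[ℝ] Patch d) (π : Equiv.Perm (Fin k)), ∀ x i, (U x) (π i) = Q (x i) := by
  induction hU using Subgroup.closure_induction with
  | mem U h =>
    rcases h with ⟨Q, hQ⟩ | ⟨π, hπ⟩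
    · exact ⟨Q, 1, hQ⟩
    · exact ⟨LinearIsometryEquiv.refl ℝ _, π, hπ⟩
  | one => exact ⟨LinearIsometryEquiv.refl ℝ _, 1, fun _ _ => rfl⟩
  | mul U₁ U₂ _ _ h₁ h₂ =>
    obtain ⟨Q₁, π₁, h₁⟩ := h₁
    obtain ⟨Q₂, π₂, h₂⟩ := h₂
    refine ⟨Q₂.trans Q₁, π₁ * π₂, fun x i => ?_⟩
    change U₁ (U₂ x) (π₁ (π₂ i)) = Q₁ (Q₂ (x i))
    rw [h₁, h₂]
  | inv U _ h =>
    obtain ⟨Q, π, h⟩ := h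
    refine ⟨Q.symm, π⁻¹, fun x i => ?_⟩
    have h1 := h (U.symm x) (π⁻¹ i)
    rw [LinearIsometryEquiv.apply_symm_apply, ← Equiv.Perm.mul_apply, mul_inv_cancel,
      Equiv.Perm.one_apply] at h1
    change (U.symm x) (π⁻¹ i) = _
    rw [h1, LinearIsometryEquiv.symm_apply_apply]

/-- The orthogonal map of the parameter space that applies `Q` to the weight. -/
noncomputable def paramIsometry (Q : Patch d ≃ₗᵢ[ℝ] Patch d) : Param d ≃ₗᵢ[ℝ] Param d where
  toLinearEquiv := (WithLp.linearEquiv 2 ℝ (Patch d × ℝ)).trans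
    ((Q.toLinearEquiv.prodCongr (LinearEquiv.refl ℝ ℝ)).trans
      (WithLp.linearEquiv 2 ℝ (Patch d × ℝ)).symm)
  norm_map' v := by
    rw [WithLp.prod_norm_eq_of_L2, WithLp.prod_norm_eq_of_L2]
    simp

lemma cnn_map {Q : Patch d ≃ₗᵢ[ℝ] Patch d} {π : Equiv.Perm (Fin k)}
    {U : Input k d ≃ₗᵢ[ℝ] Input k d} (hU : ∀ x i, (U x) (π i) = Q (x i))
    (w : Patch d) (b : ℝ) (x : Input k d) :
    cnn (WithLp.toLp 2 (Q w, b)) (U x) = cnn (WithLp.toLp 2 (w, b)) x := by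
  rw [cnn_toLp, cnn_toLp, ← Equiv.sum_comp π]
  simp_rw [hU, LinearIsometryEquiv.inner_map_map]

/-- The chain rule for an invertible linear substitution holds unconditionally: where `f` is not
differentiable, both gradients are zero. This covers the kinks of the loss. -/
lemma gradient_comp_isometryEquiv {E : Type*} [NormedAddCommGroup E] [InnerProductSpace ℝ E]
    [CompleteSpace E] (f : E → ℝ) (Q : E ≃ₗᵢ[ℝ] E) (w : E) :
    Q (gradient (f ∘ Q) w) = gradient f (Q w) := by
  refine ext_inner_right ℝ fun v => ?_
  obtain ⟨u, rfl⟩ := Q.surjective v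
  rw [LinearIsometryEquiv.inner_map_map, inner_gradient_left, inner_gradient_left]
  have h := Q.toContinuousLinearEquiv.comp_right_fderiv (f := f) (x := w)
  have h' := DFunLike.congr_fun h u
  exact h'

lemma empiricalLoss_map {Q : Patch d ≃ₗᵢ[ℝ] Patch d} {π : Equiv.Perm (Fin k)}
    {U : Input k d ≃ₗᵢ[ℝ] Input k d} (hU : ∀ x i, (U x) (π i) = Q (x i))
    (b : ℝ) (S : Fin m → Input k d × ℝ) :
    empiricalLoss b (fun j => (U (S j).1, (S j).2)) ∘ Q = empiricalLoss b S := by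
  funext w
  simp only [Function.comp, empiricalLoss, cnn_map hU]

lemma projectedStep_map {Q : Patch d ≃ₗᵢ[ℝ] Patch d} {π : Equiv.Perm (Fin k)}
    {U : Input k d ≃ₗᵢ[ℝ] Input k d} (hU : ∀ x i, (U x) (π i) = Q (x i))
    (η b' : ℝ) (v : Param d) (S : Fin m → Input k d × ℝ) :
    paramIsometry Q (projectedStep η b' v S) =
      projectedStep η b' (paramIsometry Q v) (fun j => (U (S j).1, (S j).2)) := by
  have h := gradient_comp_isometryEquiv
    (empiricalLoss v.snd (fun j => (U (S j).1, (S j).2))) Q v.fst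
  rw [empiricalLoss_map hU] at h
  change WithLp.toLp 2 (Q (NormedSpace.normalize _), b') =
    WithLp.toLp 2 (NormedSpace.normalize (Q v.fst - η • gradient (empiricalLoss v.snd _) (Q v.fst)),
      b')
  rw [← h, ← map_smul, ← map_sub, NormedSpace.normalize, NormedSpace.normalize,
    LinearIsometryEquiv.norm_map, map_smul]

lemma isEquivariant_cnnPGD_dirac (hW : IsProbabilityMeasure (Measure.dirac (0 : Param d)))
    (hW' : ∀ᵐ v ∂(Measure.dirac (0 : Param d)), v ∈ cnnParamSet d) (η b : Fin 2 → ℝ)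
    (hb : ∀ t, 0 ≤ b t) (n : ℕ) :
    IsEquivariant (cnnPGD k d (Measure.dirac 0) hW hW' η b hb n)
      (cnnGroup k d : Set (Input k d ≃ₗᵢ[ℝ] Input k d)) := by
  refine ⟨Set.range paramIsometry, ?_, ?_, ?_⟩
  · rintro _ ⟨Q, rfl⟩ v hv
    exact hv
  · intro U hU
    obtain ⟨Q, π, h⟩ := exists_of_mem_cnnGroup hU
    refine ⟨paramIsometry Q, ⟨Q, rfl⟩, fun x v _ => (cnn_map h v.fst v.snd x).symm, ?_⟩
    intro S t v _
    exact projectedStep_map h (η t) (b t) v (batch S t)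
  · rintro _ ⟨Q, rfl⟩
    change (Measure.dirac (0 : Param d)).map (paramIsometry Q) = Measure.dirac 0
    rw [Measure.map_dirac' (paramIsometry Q).continuous.measurable, map_zero]

end Equivariance

/-! ### Moments and tails of linear functionals of a standard Gaussian. -/

section Gaussian

variable {E : Type*} [NormedAddCommGroup E] [InnerProductSpace ℝ E] [FiniteDimensional ℝ E]
  [MeasurableSpace E] [BorelSpace E]

lemma memLp_inner_stdGaussian (u : E) (p : ℝ≥0∞) (hp : p ≠ ∞) :
    MemLp (fun g => ⟪u, g⟫) p (stdGaussian E) := by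
  have h := (IsGaussian.memLp_id (stdGaussian E) p hp).continuousLinearMap_comp (innerSL ℝ u)
  exact h

lemma integral_inner_stdGaussian (u : E) : ∫ g, ⟪u, g⟫ ∂(stdGaussian E) = 0 :=
  integral_strongDual_stdGaussian (innerSL ℝ u)

lemma integral_inner_mul_inner_stdGaussian (u v : E) :
    ∫ g, ⟪u, g⟫ * ⟪v, g⟫ ∂(stdGaussian E) = ⟪u, v⟫ := by
  have h := covarianceBilin_apply (IsGaussian.memLp_two_id (μ := stdGaussian E)) u v
  rw [covarianceBilin_stdGaussian, innerSL_apply_apply] at h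
  simpa using h.symm

lemma integral_inner_sq_stdGaussian (u : E) :
    ∫ g, ⟪u, g⟫ ^ 2 ∂(stdGaussian E) = ‖u‖ ^ 2 := by
  simp_rw [pow_two ⟪u, _⟫]
  rw [integral_inner_mul_inner_stdGaussian, real_inner_self_eq_norm_sq]

lemma map_inner_stdGaussian (u : E) :
    (stdGaussian E).map (fun g => ⟪u, g⟫) = gaussianReal 0 (‖u‖ ^ 2).toNNReal := by
  have h := IsGaussian.map_eq_gaussianReal (μ := stdGaussian E) (innerSL ℝ u)
  rw [integral_strongDual_stdGaussian, variance_dual_stdGaussian, innerSL_apply_norm] at h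
  exact h

lemma mgf_inner_stdGaussian (u : E) (t : ℝ) :
    mgf (fun g => ⟪u, g⟫) (stdGaussian E) t = Real.exp (‖u‖ ^ 2 * t ^ 2 / 2) := by
  rw [mgf_gaussianReal (map_inner_stdGaussian u), Real.coe_toNNReal _ (sq_nonneg _), zero_mul,
    zero_add]

lemma integrable_exp_inner_stdGaussian (u : E) (t : ℝ) :
    Integrable (fun g => Real.exp (t * ⟪u, g⟫)) (stdGaussian E) := by
  rw [← mgf_pos_iff, mgf_inner_stdGaussian]
  exact Real.exp_pos _

/-- The exponential series gives `x⁴ ≤ 4! exp |x|`, and the two exponential moments are `exp (1/2) ≤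
2`, whence `24 · (2 + 2)`. Any absolute constant would serve. -/
lemma integral_inner_pow_four_stdGaussian_le {u : E} (hu : ‖u‖ = 1) :
    ∫ g, ⟪u, g⟫ ^ 4 ∂(stdGaussian E) ≤ 96 := by
  have h1 := integrable_exp_inner_stdGaussian u 1
  have h2 := integrable_exp_inner_stdGaussian u (-1)
  have e1 := mgf_inner_stdGaussian u 1
  have e2 := mgf_inner_stdGaussian u (-1)
  rw [mgf] at e1 e2
  have h3 : ∀ x : ℝ, x ^ 4 ≤ 24 * (Real.exp (1 * x) + Real.exp (-1 * x)) := by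
    intro x
    rw [one_mul, neg_one_mul]
    have h := Real.pow_div_factorial_le_exp |x| (abs_nonneg x) 4
    have h' : |x| ^ 4 = x ^ 4 := by rw [pow_abs, abs_of_nonneg (by positivity)]
    rw [h', div_le_iff₀ (by positivity)] at h
    have h'' : ((Nat.factorial 4 : ℕ) : ℝ) = 24 := by norm_num [Nat.factorial]
    rw [h''] at h
    rcases abs_cases x with ⟨hx, _⟩ | ⟨hx, _⟩ <;> rw [hx] at h <;>
      nlinarith [Real.exp_pos x, Real.exp_pos (-x)]
  have h4 : ∫ g, ⟪u, g⟫ ^ 4 ∂(stdGaussian E) ≤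
      ∫ g, 24 * (Real.exp (1 * ⟪u, g⟫) + Real.exp (-1 * ⟪u, g⟫)) ∂(stdGaussian E) := by
    refine integral_mono_of_nonneg (Filter.Eventually.of_forall fun g => by positivity)
      ((h1.add h2).const_mul 24) (Filter.Eventually.of_forall fun g => h3 _)
  rw [integral_const_mul, integral_add h1 h2, e1, e2, hu] at h4
  have h5 : Real.exp (1 / 2) ≤ 2 := by
    have h6 : Real.exp (1 / 2) * Real.exp (1 / 2) = Real.exp 1 := by
      rw [← Real.exp_add]; norm_num
    nlinarith [Real.exp_one_lt_d9, Real.exp_pos (1 / 2)]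
  norm_num at h4
  norm_num at h5
  linarith

/-- Chernoff's bound at parameter `1`. The resulting exponential tail is weaker than the Gaussian
one but enough for the union bound over patches. -/
lemma stdGaussian_abs_inner_ge_le {u : E} (hu : ‖u‖ ≤ 1) (t : ℝ) :
    stdGaussian E {g | t ≤ |⟪u, g⟫|} ≤ ENNReal.ofReal (4 * Real.exp (-t)) := by
  have key : ∀ v : E, ‖v‖ ≤ 1 →
      stdGaussian E {g | t ≤ ⟪v, g⟫} ≤ ENNReal.ofReal (2 * Real.exp (-t)) := by
    intro v hv
    have h := measure_ge_le_exp_mul_mgf t zero_le_one (integrable_exp_inner_stdGaussian v 1)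
    rw [mgf_inner_stdGaussian, neg_one_mul] at h
    rw [← ofReal_measureReal]
    refine ENNReal.ofReal_le_ofReal (h.trans ?_)
    have h5 : Real.exp (‖v‖ ^ 2 * 1 ^ 2 / 2) ≤ 2 := by
      have h7 : Real.exp (‖v‖ ^ 2 * 1 ^ 2 / 2) ≤ Real.exp (1 / 2) :=
        Real.exp_le_exp.mpr (by nlinarith [norm_nonneg v])
      have h6 : Real.exp (1 / 2) * Real.exp (1 / 2) = Real.exp 1 := by
        rw [← Real.exp_add]; norm_num
      nlinarith [Real.exp_one_lt_d9, Real.exp_pos (1 / 2)]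
    rw [mul_comm]
    exact mul_le_mul_of_nonneg_right h5 (Real.exp_pos _).le
  have hsub : {g : E | t ≤ |⟪u, g⟫|} ⊆ {g | t ≤ ⟪u, g⟫} ∪ {g | t ≤ ⟪-u, g⟫} := by
    intro g hg
    simpa [inner_neg_left, le_abs] using hg
  calc stdGaussian E {g | t ≤ |⟪u, g⟫|}
      ≤ stdGaussian E {g | t ≤ ⟪u, g⟫} + stdGaussian E {g | t ≤ ⟪-u, g⟫} :=
        (measure_mono hsub).trans (measure_union_le _ _)
    _ ≤ ENNReal.ofReal (2 * Real.exp (-t)) + ENNReal.ofReal (2 * Real.exp (-t)) :=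
        add_le_add (key u hu) (key (-u) (by rwa [norm_neg]))
    _ = ENNReal.ofReal (4 * Real.exp (-t)) := by
        rw [← ENNReal.ofReal_add (by positivity) (by positivity)]
        ring_nf

end Gaussian

/-! ### Chebyshev bounds for empirical averages. -/

section Average

variable {Ω ι : Type*} [MeasurableSpace Ω] [Fintype ι] {μ : Measure Ω} [IsProbabilityMeasure μ]
  {m : ℕ}

/-- The empirical average of `f` over the sample `s`. -/
noncomputable def average {E : Type*} [AddCommGroup E] [Module ℝ E] (f : Ω → E)
    (s : Fin m → Ω) : E :=
  (1 / (m : ℝ)) • ∑ j, f (s j)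

lemma integral_average_sq {f : Ω → ℝ} (hf : MemLp f 2 μ) (h0 : ∫ ω, f ω ∂μ = 0) :
    ∫ s, average f s ^ 2 ∂(Measure.pi fun _ : Fin m => μ) = (∫ ω, f ω ^ 2 ∂μ) / m := by
  rcases Nat.eq_zero_or_pos m with rfl | hm
  -- For an empty sample both sides vanish, as division by zero gives zero.
  · simp [average]
  have hm' : (0 : ℝ) < m := by exact_mod_cast hm
  have hv := variance_sum_pi (μ := fun _ : Fin m => μ) (X := fun _ => f) (fun _ => hf)
  have hmem : ∀ j : Fin m, MemLp (fun s : Fin m → Ω => f (s j)) 2 (Measure.pi fun _ => μ) :=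
    fun j => hf.comp_measurePreserving (measurePreserving_eval (fun _ : Fin m => μ) j)
  have hsum : MemLp (∑ j : Fin m, fun s : Fin m → Ω => f (s j)) 2 (Measure.pi fun _ => μ) :=
    memLp_finsetSum' _ fun j _ => hmem j
  have hmean : ∫ s, (∑ j : Fin m, fun s : Fin m → Ω => f (s j)) s ∂(Measure.pi fun _ => μ) = 0 := by
    simp_rw [Finset.sum_apply]
    rw [integral_finsetSum _ fun j _ => (hmem j).integrable (by norm_num)]
    refine Finset.sum_eq_zero fun j _ => ?_
    rw [integral_comp_eval (μ := fun _ : Fin m => μ) (i := j) hf.aestronglyMeasurable, h0]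
  rw [variance_of_integral_eq_zero hsum.aemeasurable hmean] at hv
  rw [variance_of_integral_eq_zero hf.aemeasurable h0] at hv
  simp only [Finset.sum_apply, Finset.sum_const, Finset.card_univ, Fintype.card_fin,
    nsmul_eq_mul] at hv
  simp only [average, smul_eq_mul, mul_pow]
  rw [integral_const_mul, hv]
  field_simp

lemma memLp_average {f : Ω → ℝ} (hf : MemLp f 2 μ) :
    MemLp (fun s => average f s) 2 (Measure.pi fun _ : Fin m => μ) := by
  have h : MemLp (∑ j : Fin m, fun s : Fin m → Ω => f (s j)) 2 (Measure.pi fun _ => μ) :=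
    memLp_finsetSum' _ fun j _ =>
      hf.comp_measurePreserving (measurePreserving_eval (fun _ : Fin m => μ) j)
  have h2 := h.const_mul (1 / (m : ℝ))
  simpa [average, Finset.sum_apply] using h2

/-- Markov's inequality for the sum of squares. Applied to the coordinates in an orthonormal basis,
it is Chebyshev's inequality for a vector-valued average. -/
lemma measure_sum_average_sq_ge_le {f : ι → Ω → ℝ} (hf : ∀ a, MemLp (f a) 2 μ)
    (h0 : ∀ a, ∫ ω, f a ω ∂μ = 0) {t V : ℝ} (ht : 0 < t)
    (hV : ∑ a, ∫ ω, f a ω ^ 2 ∂μ ≤ V) :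
    (Measure.pi fun _ : Fin m => μ) {s | t ≤ ∑ a, average (f a) s ^ 2} ≤
      ENNReal.ofReal (V / (m * t)) := by
  have hint : ∀ a ∈ Finset.univ, Integrable (fun s => average (f a) s ^ 2)
      (Measure.pi fun _ : Fin m => μ) := fun a _ => (memLp_average (hf a)).integrable_sq
  have h := mul_meas_ge_le_integral_of_nonneg (μ := Measure.pi fun _ : Fin m => μ)
    (f := fun s => ∑ a, average (f a) s ^ 2)
    (Filter.Eventually.of_forall fun s => Finset.sum_nonneg fun a _ => sq_nonneg _)
    (integrable_finsetSum _ hint) t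
  rw [integral_finsetSum _ hint] at h
  simp_rw [fun a => integral_average_sq (m := m) (hf a) (h0 a)] at h
  rw [← Finset.sum_div] at h
  rw [← ofReal_measureReal]
  refine ENNReal.ofReal_le_ofReal ?_
  rw [← div_div, le_div_iff₀ ht, mul_comm]
  exact h.trans (div_le_div_of_nonneg_right hV (Nat.cast_nonneg m))

end Average

/-! ### Independence of the two batches. -/

section Batches

lemma measurePreserving_comp_injective {ι κ Ω : Type*} [Fintype ι] [Fintype κ]
    [MeasurableSpace Ω] (μ : Measure Ω) [IsProbabilityMeasure μ] {e : ι → κ}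
    (he : Function.Injective e) :
    MeasurePreserving (fun (s : κ → Ω) i => s (e i)) (Measure.pi fun _ => μ)
      (Measure.pi fun _ => μ) := by
  have hm : Measurable (fun (s : κ → Ω) i => s (e i)) :=
    measurable_pi_lambda _ fun i => measurable_pi_apply _
  refine ⟨hm, (Measure.pi_eq fun A hA => ?_).symm⟩
  rw [Measure.map_apply hm (MeasurableSet.univ_pi hA)]
  -- The preimage of a box is again a box, unconstrained in the coordinates outside the range of
  -- `e`; these contribute factors of mass `1`.
  have hpre : (fun (s : κ → Ω) i => s (e i)) ⁻¹' Set.pi Set.univ A =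
      Set.pi Set.univ (Function.extend e A fun _ => Set.univ) := by
    ext s
    simp only [Set.mem_preimage, Set.mem_univ_pi]
    refine ⟨fun h j => ?_, fun h i => by simpa [he.extend_apply] using h (e i)⟩
    by_cases hj : ∃ i, e i = j
    · obtain ⟨i, rfl⟩ := hj
      rw [he.extend_apply]
      exact h i
    · rw [Function.extend_apply' _ _ _ hj]
      trivial
  rw [hpre, Measure.pi_pi]
  symm
  refine Fintype.prod_of_injective e he _ _ (fun j hj => ?_) fun i => ?_
  · rw [Function.extend_apply' _ _ _ (by simpa using hj), measure_univ]
  · rw [he.extend_apply]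

lemma measurePreserving_batch {Ω : Type*} [MeasurableSpace Ω] (μ : Measure Ω)
    [IsProbabilityMeasure μ] (n : ℕ) :
    MeasurePreserving (fun s : Fin n → Ω => (batch s 0, batch s 1)) (Measure.pi fun _ => μ)
      ((Measure.pi fun _ => μ).prod (Measure.pi fun _ => μ)) := by
  let e : Fin (n / 2) ⊕ Fin (n / 2) → Fin n :=
    Sum.elim (fun j => ⟨(0 : Fin 2) * (n / 2) + j, by have := j.2; simp; omega⟩)
      (fun j => ⟨(1 : Fin 2) * (n / 2) + j, by have := j.2; simp; omega⟩)
  have he : Function.Injective e := by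
    rintro (i | i) (j | j) h <;> have hi := i.2 <;> have hj := j.2 <;>
      simp [e, Fin.ext_iff] at h ⊢ <;> omega
  exact (measurePreserving_sumPiEquivProdPi
    (fun _ : Fin (n / 2) ⊕ Fin (n / 2) => μ)).comp (measurePreserving_comp_injective μ he)

end Batches

/-! ### Latent variables and the risk of the linear network. -/

section Latent

variable {k d : ℕ}

/-- The patch index, the label and the noise from which a labelled sample is built. -/
abbrev Latent (k d : ℕ) := (Fin k × Bool) × Input k d

/-- The uniform distribution on pairs of a patch index and a label. -/
noncomputable def indexMeasure (k : ℕ) : Measure (Fin k × Bool) :=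
  ((k : ℝ≥0∞)⁻¹ * 2⁻¹) • Measure.count

lemma isProbabilityMeasure_indexMeasure (hk : 0 < k) :
    IsProbabilityMeasure (indexMeasure k) := by
  refine ⟨?_⟩
  have hk' : (k : ℝ≥0∞) ≠ 0 := by exact_mod_cast hk.ne'
  rw [indexMeasure, Measure.smul_apply, Measure.count_univ]
  simp only [ENat.card_eq_coe_fintype_card, Fintype.card_prod, Fintype.card_fin,
    Fintype.card_bool, smul_eq_mul]
  push_cast
  rw [mul_mul_mul_comm, ENNReal.inv_mul_cancel hk' (ENNReal.natCast_ne_top k),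
    ENNReal.inv_mul_cancel (by norm_num) (by norm_num), one_mul]

/-- The distribution of the latent variables. -/
noncomputable def latentMeasure (k d : ℕ) : Measure (Latent k d) :=
  (indexMeasure k).prod (stdGaussian (Input k d))

/-- The label encoded by a Boolean. -/
def sign (ε : Bool) : ℝ := if ε then 1 else -1

lemma sign_mul_self (ε : Bool) : sign ε * sign ε = 1 := by
  cases ε <;> norm_num [sign]

/-- The labelled sample built from latent variables, with the noise multiplied by the label. -/
noncomputable def sample (w : Patch d) (σ : ℝ) (a : Latent k d) : Input k d × ℝ :=
  (sign a.1.2 • (signal w a.1.1 + σ • a.2), sign a.1.2)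

lemma measurable_sample (w : Patch d) (σ : ℝ) : Measurable (sample (k := k) w σ) := by
  refine measurable_from_prod_countable_right fun p => ?_
  exact Continuous.measurable (f := fun g : Input k d =>
    (sign p.2 • (signal w p.1 + σ • g), sign p.2)) (by fun_prop)

lemma signal_apply_self (w : Patch d) (i : Fin k) : (signal w i) i = w := by
  simp [signal]

lemma signal_apply_of_ne (w : Patch d) {i j : Fin k} (h : j ≠ i) : (signal w i) j = 0 := by
  simp [signal, h]

lemma sum_signal (w : Patch d) (i : Fin k) : ∑ j, (signal w i) j = w := by
  simp [signal]

lemma inner_signal (w : Patch d) (i : Fin k) (g : Input k d) : ⟪signal w i, g⟫ = ⟪w, g i⟫ := by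
  rw [PiLp.inner_apply, Finset.sum_eq_single i]
  · rw [signal_apply_self]
  · intro j _ h
    rw [signal_apply_of_ne w h, inner_zero_left]
  · simp

lemma norm_signal (w : Patch d) (i : Fin k) : ‖signal w i‖ = ‖w‖ := by
  have h : ‖signal w i‖ ^ 2 = ‖w‖ ^ 2 := by
    rw [← real_inner_self_eq_norm_sq, inner_signal, signal_apply_self, real_inner_self_eq_norm_sq]
  exact (pow_left_inj₀ (norm_nonneg _) (norm_nonneg _) two_ne_zero).mp h

lemma map_apply_stdGaussian (i : Fin k) :
    (stdGaussian (Input k d)).map (fun g => g i) = stdGaussian (Patch d) := by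
  have hm : Measurable (fun g : Input k d => g i) := by fun_prop
  apply Measure.ext_of_charFun
  ext t
  rw [charFun_apply, integral_map hm.aemeasurable (Measurable.aestronglyMeasurable (by fun_prop)),
    charFun_stdGaussian]
  have h := charFun_stdGaussian (signal t i)
  rw [norm_signal, charFun_apply] at h
  have hc : ∀ g : Input k d, ⟪g, signal t i⟫ = ⟪g i, t⟫ := fun g => by
    rw [real_inner_comm, inner_signal, real_inner_comm]
  simp_rw [hc] at h
  exact h

/-- The noise in the signal patch. -/
def signalNoise (a : Latent k d) : Patch d := a.2 a.1.1

lemma measurePreserving_signalNoise (hk : 0 < k) :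
    MeasurePreserving (signalNoise (k := k) (d := d)) (latentMeasure k d)
      (stdGaussian (Patch d)) := by
  have := isProbabilityMeasure_indexMeasure hk
  have hm : Measurable (signalNoise (k := k) (d := d)) :=
    measurable_from_prod_countable_right fun p => by
      change Measurable fun g : Input k d => g p.1
      fun_prop
  refine ⟨hm, Measure.ext fun A hA => ?_⟩
  rw [Measure.map_apply hm hA, latentMeasure, Measure.prod_apply (hm hA)]
  have h : ∀ p : Fin k × Bool, stdGaussian (Input k d) (Prod.mk p ⁻¹' (signalNoise ⁻¹' A)) =
      stdGaussian (Patch d) A := by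
    intro p
    rw [← map_apply_stdGaussian p.1, Measure.map_apply (by fun_prop) hA]
    rfl
  simp_rw [h, lintegral_const, measure_univ, mul_one]

lemma isProbabilityMeasure_latentMeasure (hk : 0 < k) :
    IsProbabilityMeasure (latentMeasure k d) := by
  have := isProbabilityMeasure_indexMeasure hk
  unfold latentMeasure
  infer_instance

lemma measurePreserving_noise (hk : 0 < k) :
    MeasurePreserving Prod.snd (latentMeasure k d) (stdGaussian (Input k d)) := by
  have := isProbabilityMeasure_indexMeasure hk
  exact measurePreserving_snd

lemma map_neg_stdGaussian {E : Type*} [NormedAddCommGroup E] [InnerProductSpace ℝ E]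
    [FiniteDimensional ℝ E] [MeasurableSpace E] [BorelSpace E] :
    (stdGaussian E).map (fun g => -g) = stdGaussian E :=
  stdGaussian_map (LinearIsometryEquiv.neg ℝ)

/-- Multiplying the noise by the label does not change its law, because the Gaussian is symmetric.
With this parametrization the label factors out of the input and later cancels against itself. -/
lemma map_sample (hk : 0 < k) (w : Patch d) (σ : ℝ) :
    (latentMeasure k d).map (sample w σ) = dsd k d w σ := by
  have := isProbabilityMeasure_indexMeasure hk
  refine Measure.ext fun A hA => ?_
  have hms := measurable_sample (k := k) w σ
  have h1 : ∀ (i : Fin k) (ε : Bool),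
      stdGaussian (Input k d) (Prod.mk (i, ε) ⁻¹' (sample w σ ⁻¹' A)) =
      (stdGaussian (Input k d)).map (fun g => (sign ε • signal w i + σ • g, sign ε)) A := by
    intro i ε
    have hc : Measurable (fun g : Input k d => (sign ε • signal w i + σ • g, sign ε)) :=
      Continuous.measurable (by fun_prop)
    cases ε with
    | true =>
      rw [Measure.map_apply hc hA]
      congr 1
      ext g
      simp [sample, sign]
    | false =>
      rw [← map_neg_stdGaussian, Measure.map_map hc (by fun_prop), Measure.map_apply
        (hc.comp (by fun_prop)) hA, map_neg_stdGaussian]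
      congr 1
      ext g
      simp [sample, sign, add_comm]
  rw [Measure.map_apply hms hA, latentMeasure, Measure.prod_apply (hms hA), indexMeasure,
    lintegral_smul_measure, lintegral_count, tsum_fintype, Fintype.sum_prod_type]
  simp_rw [h1]
  simp only [dsd, Measure.smul_apply, Measure.finsetSum_apply, smul_eq_mul]
  rw [mul_assoc, Finset.mul_sum]
  congr 1
  refine Finset.sum_congr rfl fun i _ => ?_
  rw [Finset.sum_pair (by norm_num : (1 : ℝ) ≠ -1), Fintype.sum_bool]
  simp [sign]

lemma map_pi_sample (hk : 0 < k) (w : Patch d) (σ : ℝ) (n : ℕ) :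
    (Measure.pi fun _ : Fin n => latentMeasure k d).map (fun s j => sample w σ (s j)) =
      Measure.pi fun _ => dsd k d w σ := by
  have := isProbabilityMeasure_latentMeasure (d := d) hk
  rw [← map_sample hk w σ]
  have : IsProbabilityMeasure ((latentMeasure k d).map (sample w σ)) :=
    Measure.isProbabilityMeasure_map (measurable_sample w σ).aemeasurable
  exact Measure.pi_map_pi fun _ => (measurable_sample w σ).aemeasurable

/-- The input all of whose patches are `w`. -/
def repeatPatch (k : ℕ) (w : Patch d) : Input k d := WithLp.toLp 2 fun _ => w

lemma inner_repeatPatch (w : Patch d) (g : Input k d) :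
    ⟪repeatPatch k w, g⟫ = ⟪w, ∑ i, g i⟫ := by
  rw [PiLp.inner_apply, inner_sum]
  rfl

lemma norm_repeatPatch_sq (w : Patch d) : ‖repeatPatch k w‖ ^ 2 = k * ‖w‖ ^ 2 := by
  rw [← real_inner_self_eq_norm_sq, inner_repeatPatch]
  simp [repeatPatch, ← Nat.cast_smul_eq_nsmul ℝ, real_inner_smul_right]

/-- At bias zero the network is the linear functional `x ↦ ⟪w, ∑ x i⟫`, so the error splits into a
squared bias in the direction `wStar` and the variance of the noise accumulated over `k` patches. -/
lemma risk_linear_le (hk : 0 < k) (w wStar : Patch d) (σ : ℝ) :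
    risk (cnn (WithLp.toLp 2 (w, 0))) (dsd k d wStar σ) ≤
      ENNReal.ofReal ((1 - ⟪w, wStar⟫) ^ 2 + σ ^ 2 * k * ‖w‖ ^ 2) := by
  have := isProbabilityMeasure_latentMeasure (d := d) hk
  rw [risk, ← map_sample hk]
  refine (lintegral_map_le _ _).trans ?_
  have h1 : ∀ a : Latent k d, ENNReal.ofReal
      ((cnn (WithLp.toLp 2 (w, 0)) (sample wStar σ a).1 - (sample wStar σ a).2) ^ 2) =
      ENNReal.ofReal ((⟪w, wStar⟫ - 1 + σ * ⟪repeatPatch k w, a.2⟫) ^ 2) := by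
    intro a
    congr 1
    have h2 : cnn (WithLp.toLp 2 (w, 0)) (sample wStar σ a).1 =
        sign a.1.2 * (⟪w, wStar⟫ + σ * ⟪repeatPatch k w, a.2⟫) := by
      simp only [cnn_toLp, lsa_zero_left, sample]
      rw [← inner_sum]
      simp only [PiLp.smul_apply, PiLp.add_apply]
      rw [← Finset.smul_sum, Finset.sum_add_distrib, sum_signal, ← Finset.smul_sum,
        inner_repeatPatch, real_inner_smul_right, inner_add_right, real_inner_smul_right]
    rw [h2]
    have h3 := sign_mul_self a.1.2
    simp only [sample]
    linear_combination (⟪w, wStar⟫ - 1 + σ * ⟪repeatPatch k w, a.2⟫) ^ 2 * h3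
  simp_rw [h1]
  rw [(measurePreserving_noise hk).lintegral_comp (f := fun g : Input k d => ENNReal.ofReal
      ((⟪w, wStar⟫ - 1 + σ * ⟪repeatPatch k w, g⟫) ^ 2)) (by fun_prop)]
  have hL := memLp_inner_stdGaussian (repeatPatch k w) 2 (by norm_num)
  have hL1 := hL.integrable (by norm_num)
  have hL2 := hL.integrable_sq
  have hexp : ∀ g : Input k d, (⟪w, wStar⟫ - 1 + σ * ⟪repeatPatch k w, g⟫) ^ 2 =
      (1 - ⟪w, wStar⟫) ^ 2 + (2 * (⟪w, wStar⟫ - 1) * σ * ⟪repeatPatch k w, g⟫ +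
        σ ^ 2 * ⟪repeatPatch k w, g⟫ ^ 2) := fun g => by ring
  simp_rw [hexp]
  have hi2 : Integrable (fun g => 2 * (⟪w, wStar⟫ - 1) * σ * ⟪repeatPatch k w, g⟫ +
      σ ^ 2 * ⟪repeatPatch k w, g⟫ ^ 2) (stdGaussian (Input k d)) :=
    (hL1.const_mul _).add (hL2.const_mul _)
  have hi3 : Integrable (fun g => (1 - ⟪w, wStar⟫) ^ 2 +
      (2 * (⟪w, wStar⟫ - 1) * σ * ⟪repeatPatch k w, g⟫ +
      σ ^ 2 * ⟪repeatPatch k w, g⟫ ^ 2)) (stdGaussian (Input k d)) :=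
    (integrable_const _).add hi2
  rw [← ofReal_integral_eq_lintegral_ofReal hi3
    (Filter.Eventually.of_forall fun g => by
      beta_reduce; rw [Pi.zero_apply, ← hexp]; positivity), integral_add (integrable_const _) hi2,
    integral_add (hL1.const_mul _) (hL2.const_mul _), integral_const_mul, integral_const_mul,
    integral_inner_stdGaussian, integral_inner_sq_stdGaussian, norm_repeatPatch_sq]
  simp [mul_assoc]

end Latent

/-! ### Perturbation of normalized vectors. -/

section Geometry

variable {E : Type*} [NormedAddCommGroup E] [InnerProductSpace ℝ E]

lemma norm_normalize_le (v : E) : ‖NormedSpace.normalize v‖ ≤ 1 := by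
  rw [NormedSpace.normalize, norm_smul, norm_inv, norm_norm]
  exact inv_mul_le_one

lemma norm_normalize_of_ne {v : E} (hv : v ≠ 0) : ‖NormedSpace.normalize v‖ = 1 := by
  rw [NormedSpace.normalize, norm_smul, norm_inv, norm_norm]
  exact inv_mul_cancel₀ (norm_ne_zero_iff.mpr hv)

lemma normalize_smul_of_pos {c : ℝ} (hc : 0 < c) (v : E) :
    NormedSpace.normalize (c • v) = NormedSpace.normalize v := by
  rw [NormedSpace.normalize, NormedSpace.normalize, norm_smul, Real.norm_of_nonneg hc.le, mul_inv,
    smul_smul, mul_right_comm, inv_mul_cancel₀ hc.ne', one_mul]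

lemma inner_normalize_left (v u : E) :
    ⟪NormedSpace.normalize v, u⟫ = ⟪v, u⟫ / ‖v‖ := by
  rw [NormedSpace.normalize, real_inner_smul_left, inv_mul_eq_div]

lemma inner_normalize_ge_of_norm_sub_le {u w : E} (hw : ‖w‖ = 1) (h : ‖u - w‖ ≤ 1 / 100) :
    49 / 50 ≤ ⟪NormedSpace.normalize u, w⟫ := by
  have h1 : ‖u‖ ≤ 101 / 100 := by
    have h2 := norm_add_le (u - w) w
    rw [sub_add_cancel, hw] at h2
    linarith
  have h3 : 99 / 100 ≤ ‖u‖ := by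
    have h2 := norm_sub_norm_le w u
    rw [hw, norm_sub_rev] at h2
    linarith
  have h4 : 99 / 100 ≤ ⟪u, w⟫ := by
    have h5 : ⟪u, w⟫ = ⟪u - w, w⟫ + 1 := by
      rw [inner_sub_left, real_inner_self_eq_norm_sq, hw]; ring
    have h6 := neg_le_of_abs_le (abs_real_inner_le_norm (u - w) w)
    rw [hw, mul_one] at h6
    linarith
  rw [inner_normalize_left, le_div_iff₀ (by linarith)]
  linarith

/-- The inner product with `w` is at least `1/2`, while the norm is at most `1 + r/8 ≤ r/4`. Only
the component of the perturbation along `w` must be small; in the other directions it may be large.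
-/
lemma inner_normalize_add_ge {w v : E} {r : ℝ} (hw : ‖w‖ = 1) (hr : 8 ≤ r)
    (h1 : -(1 / 2) ≤ ⟪w, v⟫) (h2 : ‖v‖ ≤ r / 8) :
    2 / r ≤ ⟪NormedSpace.normalize (w + v), w⟫ ∧ ‖NormedSpace.normalize (w + v)‖ = 1 := by
  have h3 : 1 / 2 ≤ ⟪w + v, w⟫ := by
    rw [inner_add_left, real_inner_self_eq_norm_sq, hw, real_inner_comm]
    linarith
  have hne : w + v ≠ 0 := by
    intro h
    rw [h, inner_zero_left] at h3
    linarith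
  have hpos : 0 < ‖w + v‖ := norm_pos_iff.mpr hne
  refine ⟨?_, norm_normalize_of_ne hne⟩
  have h4 := norm_add_le w v
  rw [inner_normalize_left, div_le_div_iff₀ (by linarith) hpos]
  nlinarith

end Geometry

/-! ### Closed forms of the two gradient steps. -/

section Steps

variable {k d m : ℕ}

/-- The summand of the first gradient step. -/
noncomputable def firstTerm (wStar : Patch d) (σ : ℝ) (a : Latent k d) : Patch d :=
  wStar + σ • ∑ i, a.2 i

/-- The summand of the second gradient step when exactly the signal patch is active. -/
noncomputable def secondTerm (wStar : Patch d) (σ b : ℝ) (w g : Patch d) : Patch d :=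
  (1 - ⟪w, wStar⟫ + b - σ * ⟪w, g⟫) • (wStar + σ • g)

lemma projectedStep_first (wStar : Patch d) (σ b' : ℝ) (s : Fin m → Latent k d) :
    projectedStep (1 / 2) b' 0 (fun j => sample wStar σ (s j)) =
      WithLp.toLp 2 (NormedSpace.normalize (average (firstTerm wStar σ) s), b') := by
  have h := gradient_empiricalLoss (b := 0) (w := (0 : Patch d))
    (S := fun j => sample wStar σ (s j)) (c := fun _ _ => 1) fun _ _ => hasDerivAt_lsa_zero _
  change WithLp.toLp 2 (NormedSpace.normalize ((0 : Patch d) - (1 / 2 : ℝ) •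
    gradient (empiricalLoss 0 _) 0), b') = _
  rw [h]
  congr 3
  rw [smul_neg, zero_sub, neg_neg, smul_smul, average]
  congr 1
  · ring
  refine Finset.sum_congr rfl fun j _ => ?_
  have h1 : cnn (WithLp.toLp 2 ((0 : Patch d), (0 : ℝ))) (sample wStar σ (s j)).1 = 0 := by
    rw [cnn_toLp]
    simp [lsa_zero_left]
  rw [h1, sub_zero]
  simp only [sample, one_smul, PiLp.smul_apply, PiLp.add_apply, firstTerm]
  rw [← Finset.smul_sum, Finset.sum_add_distrib, sum_signal, ← Finset.smul_sum, smul_smul,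
    sign_mul_self, one_smul]

/-- The hypotheses put the signal patch strictly above the threshold and all other patches strictly
below it in absolute value. Since the activation is odd, the label appears twice in each summand and
cancels. -/
lemma projectedStep_second {wStar w : Patch d} {σ b η b' : ℝ} {s : Fin m → Latent k d}
    (hb : 0 ≤ b) (hw : 2 * b ≤ ⟪w, wStar⟫) (hs : ∀ j i, |σ * ⟪w, (s j).2 i⟫| < b) :
    projectedStep η b' (WithLp.toLp 2 (w, b)) (fun j => sample wStar σ (s j)) =
      WithLp.toLp 2 (NormedSpace.normalize (w + (2 * η) •
        average (fun a => secondTerm wStar σ b w (signalNoise a)) s), b') := by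
  have hact : ∀ j, b < ⟪w, wStar + σ • signalNoise (s j)⟫ := by
    intro j
    rw [inner_add_right, real_inner_smul_right]
    have := (abs_lt.mp (hs j (s j).1.1)).1
    unfold signalNoise
    linarith
  have hpatch : ∀ j i, (signal wStar (s j).1.1 + σ • (s j).2) i =
      if i = (s j).1.1 then wStar + σ • signalNoise (s j) else σ • (s j).2 i := by
    intro j i
    split_ifs with h
    · rw [h, PiLp.add_apply, signal_apply_self]
      rfl
    · rw [PiLp.add_apply, signal_apply_of_ne _ h, zero_add, PiLp.smul_apply]
  have hder : ∀ j i, HasDerivAt (lsa b) (if i = (s j).1.1 then 1 else 0)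
      ⟪w, (signal wStar (s j).1.1 + σ • (s j).2) i⟫ := by
    intro j i
    rw [hpatch]
    split_ifs with h
    · exact hasDerivAt_lsa_of_lt hb (hact j)
    · rw [real_inner_smul_right]
      exact hasDerivAt_lsa_of_abs_lt (hs j i)
  have hval : ∀ j, ∑ i, lsa b ⟪w, (signal wStar (s j).1.1 + σ • (s j).2) i⟫ =
      ⟪w, wStar⟫ + σ * ⟪w, signalNoise (s j)⟫ - b := by
    intro j
    rw [Finset.sum_eq_single (s j).1.1]
    · rw [hpatch, if_pos rfl, lsa_eq_sub hb (hact j).le, inner_add_right, real_inner_smul_right]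
    · intro i _ hi
      rw [hpatch, if_neg hi, real_inner_smul_right, lsa_eq_zero (hs j i).le]
    · simp
  have hcase : ∀ ε, sign ε = 1 ∨ sign ε = -1 := by
    intro ε
    cases ε <;> simp [sign]
  have h := gradient_empiricalLoss (b := b) (w := w) (S := fun j => sample wStar σ (s j))
    (c := fun j i => if i = (s j).1.1 then 1 else 0) fun j i => by
      simp only [sample, PiLp.smul_apply, real_inner_smul_right]
      rcases hcase (s j).1.2 with h | h <;> rw [h]
      · rw [one_mul]
        exact hder j i
      · rw [neg_one_mul]
        exact hasDerivAt_lsa_neg (hder j i)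
  have hcnn : ∀ j, cnn (WithLp.toLp 2 (w, b)) (sample wStar σ (s j)).1 =
      sign (s j).1.2 * (⟪w, wStar⟫ + σ * ⟪w, signalNoise (s j)⟫ - b) := by
    intro j
    rw [← hval, cnn_toLp, Finset.mul_sum]
    refine Finset.sum_congr rfl fun i _ => ?_
    simp only [sample, PiLp.smul_apply, real_inner_smul_right]
    rcases hcase (s j).1.2 with h | h <;> rw [h]
    · rw [one_mul, one_mul]
    · rw [neg_one_mul, neg_one_mul, lsa_neg]
  change WithLp.toLp 2 (NormedSpace.normalize (w - η • gradient (empiricalLoss b _) w), b') = _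
  rw [h]
  congr 3
  rw [smul_neg, sub_neg_eq_add, average, smul_smul, smul_smul]
  congr 2
  · ring
  refine Finset.sum_congr rfl fun j _ => ?_
  rw [hcnn]
  simp only [ite_smul, one_smul, zero_smul, Finset.sum_ite_eq', Finset.mem_univ, if_true]
  simp only [sample, PiLp.smul_apply]
  rw [hpatch, if_pos rfl, smul_smul, secondTerm]
  congr 1
  linear_combination (1 - ⟪w, wStar⟫ + b - σ * ⟪w, signalNoise (s j)⟫) * sign_mul_self (s j).1.2

end Steps

/-! ### Coordinates of vector-valued averages. -/

section Average

variable {Ω E : Type*} [NormedAddCommGroup E] [InnerProductSpace ℝ E] {m : ℕ}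

lemma inner_average (u : E) (f : Ω → E) (s : Fin m → Ω) :
    ⟪u, average f s⟫ = average (fun ω => ⟪u, f ω⟫) s := by
  rw [average, average, real_inner_smul_right, inner_sum, smul_eq_mul]

lemma average_add_const (hm : 0 < m) (c : E) (f : Ω → E) (s : Fin m → Ω) :
    average (fun ω => c + f ω) s = c + average f s := by
  have hm' : (m : ℝ) ≠ 0 := by exact_mod_cast hm.ne'
  rw [average, average, Finset.sum_add_distrib, smul_add]
  simp [← Nat.cast_smul_eq_nsmul ℝ, smul_smul, hm']

lemma sum_average_inner_sq {ι : Type*} [Fintype ι] (e : OrthonormalBasis ι ℝ E) (f : Ω → E)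
    (s : Fin m → Ω) : ∑ a, average (fun ω => ⟪e a, f ω⟫) s ^ 2 = ‖average f s‖ ^ 2 := by
  simp_rw [← inner_average]
  exact e.sum_sq_inner_right _

end Average

/-! ### Concentration in the first step. -/

section FirstStep

variable {k d m : ℕ}

lemma memLp_noise (hk : 0 < k) (σ : ℝ) (u : Patch d) :
    MemLp (fun a : Latent k d => ⟪u, σ • ∑ i, a.2 i⟫) 2 (latentMeasure k d) := by
  have h := ((memLp_inner_stdGaussian (repeatPatch k u) 2 (by norm_num)).const_mul
    σ).comp_measurePreserving (measurePreserving_noise hk)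
  refine h.congr_norm ?_ (Filter.Eventually.of_forall fun a => ?_)
  · refine h.aestronglyMeasurable.congr (Filter.Eventually.of_forall fun a => ?_)
    simp only [Function.comp, inner_repeatPatch, real_inner_smul_right]
  · simp only [Function.comp, inner_repeatPatch, real_inner_smul_right]

lemma integral_noise (hk : 0 < k) (σ : ℝ) (u : Patch d) :
    ∫ a : Latent k d, ⟪u, σ • ∑ i, a.2 i⟫ ∂(latentMeasure k d) = 0 := by
  simp_rw [real_inner_smul_right, ← inner_repeatPatch]
  rw [integral_const_mul, ← integral_map (φ := Prod.snd)
    (f := fun g : Input k d => ⟪repeatPatch k u, g⟫) (by fun_prop)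
    (Measurable.aestronglyMeasurable (by fun_prop)), (measurePreserving_noise hk).map_eq,
    integral_inner_stdGaussian, mul_zero]

lemma integral_noise_sq (hk : 0 < k) (σ : ℝ) (u : Patch d) :
    ∫ a : Latent k d, ⟪u, σ • ∑ i, a.2 i⟫ ^ 2 ∂(latentMeasure k d) =
      σ ^ 2 * (k * ‖u‖ ^ 2) := by
  simp_rw [real_inner_smul_right, ← inner_repeatPatch, mul_pow]
  rw [integral_const_mul, ← integral_map (φ := Prod.snd)
    (f := fun g : Input k d => ⟪repeatPatch k u, g⟫ ^ 2) (by fun_prop)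
    (Measurable.aestronglyMeasurable (by fun_prop)), (measurePreserving_noise hk).map_eq,
    integral_inner_sq_stdGaussian, norm_repeatPatch_sq]

lemma measure_first_bad_le (hk : 64 ≤ k) (hm : 0 < m) {wStar : Patch d} (hw : ‖wStar‖ = 1)
    {σ : ℝ} (h1 : σ ^ 2 * k ≤ 1 / 10 ^ 10) (h2 : σ ^ 2 * d ≤ m / 10 ^ 10) :
    (Measure.pi fun _ : Fin m => latentMeasure k d)
      {s | ¬ (2 / √k ≤ ⟪NormedSpace.normalize (average (firstTerm wStar σ) s), wStar⟫ ∧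
        ‖NormedSpace.normalize (average (firstTerm wStar σ) s)‖ = 1)} ≤
      ENNReal.ofReal (1 / 10 ^ 5) := by
  have hk0 : 0 < k := by omega
  have hkR : (64 : ℝ) ≤ k := by exact_mod_cast hk
  have hmR : (1 : ℝ) ≤ m := by exact_mod_cast hm
  have := isProbabilityMeasure_latentMeasure (d := d) hk0
  let f : Latent k d → Patch d := fun a => σ • ∑ i, a.2 i
  let e := EuclideanSpace.basisFun (Fin d) ℝ
  have b1 := measure_sum_average_sq_ge_le (m := m) (ι := Unit) (μ := latentMeasure k d)
    (f := fun _ a => ⟪wStar, f a⟫) (fun _ => memLp_noise hk0 σ wStar)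
    (fun _ => integral_noise hk0 σ wStar) (t := 1 / 4) (V := σ ^ 2 * k) (by norm_num)
    (by simp [f, integral_noise_sq hk0, hw])
  -- The threshold `k / 64` is the square of `√k / 8`. The factor `k` in it cancels the `k` in the
  -- variance, so only `σ² d / m` has to be small.
  have b2 := measure_sum_average_sq_ge_le (m := m) (ι := Fin d) (μ := latentMeasure k d)
    (f := fun i a => ⟪e i, f a⟫) (fun i => memLp_noise hk0 σ (e i))
    (fun i => integral_noise hk0 σ (e i)) (t := k / 64) (V := σ ^ 2 * k * d) (by positivity)
    (by simp [f, integral_noise_sq hk0, e.norm_eq_one]; exact le_of_eq (by ring))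
  refine (measure_mono (fun s hs => ?_)).trans ((measure_union_le _ _).trans
    ((add_le_add b1 b2).trans ?_))
  · by_contra hcon
    simp only [Set.mem_union, Set.mem_ofPred_eq, not_or, not_le, sum_average_inner_sq] at hcon
    obtain ⟨c1, c2⟩ := hcon
    apply hs
    have hav : average (firstTerm wStar σ) s = wStar + average f s :=
      average_add_const hm wStar f s
    rw [hav]
    have hs8 : 8 ≤ √(k : ℝ) := Real.le_sqrt_of_sq_le (by linarith)
    refine inner_normalize_add_ge hw hs8 ?_ ?_
    · rw [inner_average]
      rw [Finset.univ_unique, Finset.sum_singleton] at c1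
      exact (abs_le.mp (abs_le_of_sq_le_sq (by linarith) (by norm_num))).1
    · refine le_of_sq_le_sq ?_ (by positivity)
      rw [div_pow, Real.sq_sqrt (by positivity)]
      linarith
  · rw [← ENNReal.ofReal_add (by positivity) (by positivity)]
    refine ENNReal.ofReal_le_ofReal ?_
    have e1 : σ ^ 2 * k / (m * (1 / 4)) ≤ 4 / 10 ^ 10 := by
      rw [div_le_div_iff₀ (by positivity) (by positivity)]
      linarith
    have e2 : σ ^ 2 * k * d / (m * (k / 64)) ≤ 64 / 10 ^ 10 := by
      have e3 : σ ^ 2 * k * d / (m * (k / 64)) = 64 * (σ ^ 2 * d / m) := by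
        field_simp
      rw [e3]
      have e4 : σ ^ 2 * d / m ≤ 1 / 10 ^ 10 := by
        rw [div_le_iff₀ (by positivity)]
        linarith
      linarith
    linarith

end FirstStep

/-! ### Concentration in the second step. -/

section SecondStep

variable {k d m : ℕ}

lemma measure_active_noise_le (hk : 0 < k) {w : Patch d} (hw : ‖w‖ = 1) {σ b : ℝ} (hσ : 0 < σ) :
    (Measure.pi fun _ : Fin m => latentMeasure k d)
      {s | ∃ j i, b ≤ |σ * ⟪w, (s j).2 i⟫|} ≤
      ENNReal.ofReal (m * (k * (4 * Real.exp (-(b / σ))))) := by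
  have := isProbabilityMeasure_latentMeasure (d := d) hk
  have h1 : ∀ (j : Fin m) (i : Fin k), (Measure.pi fun _ : Fin m => latentMeasure k d)
      {s | b ≤ |σ * ⟪w, (s j).2 i⟫|} ≤ ENNReal.ofReal (4 * Real.exp (-(b / σ))) := by
    intro j i
    have hA : MeasurableSet {g : Input k d | b / σ ≤ |⟪signal w i, g⟫|} :=
      measurableSet_le measurable_const (by fun_prop)
    have h2 := (measurePreserving_noise (d := d) hk).comp
      (measurePreserving_eval (fun _ : Fin m => latentMeasure k d) j)
    have h3 := h2.measure_preimage hA.nullMeasurableSet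
    have h4 : {s : Fin m → Latent k d | b ≤ |σ * ⟪w, (s j).2 i⟫|} =
        (Prod.snd ∘ Function.eval j) ⁻¹' {g : Input k d | b / σ ≤ |⟪signal w i, g⟫|} := by
      ext s
      simp only [Set.mem_ofPred_eq, Set.mem_preimage, Function.comp, Function.eval, inner_signal,
        abs_mul, abs_of_pos hσ]
      rw [div_le_iff₀' hσ]
    rw [h4, h3]
    exact stdGaussian_abs_inner_ge_le (by rw [norm_signal, hw]) _
  have h5 : {s : Fin m → Latent k d | ∃ j i, b ≤ |σ * ⟪w, (s j).2 i⟫|} =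
      ⋃ j : Fin m, ⋃ i : Fin k, {s | b ≤ |σ * ⟪w, (s j).2 i⟫|} := by
    ext s
    simp
  rw [h5]
  calc _ ≤ ∑ j : Fin m, ∑ i : Fin k, (Measure.pi fun _ : Fin m => latentMeasure k d)
        {s | b ≤ |σ * ⟪w, (s j).2 i⟫|} :=
        (measure_iUnion_fintype_le _ _).trans
          (Finset.sum_le_sum fun j _ => measure_iUnion_fintype_le _ _)
    _ ≤ ∑ j : Fin m, ∑ i : Fin k, ENNReal.ofReal (4 * Real.exp (-(b / σ))) :=
        Finset.sum_le_sum fun j _ => Finset.sum_le_sum fun i _ => h1 j i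
    _ = ENNReal.ofReal (m * (k * (4 * Real.exp (-(b / σ))))) := by
        rw [ENNReal.ofReal_mul (Nat.cast_nonneg m), ENNReal.ofReal_mul (Nat.cast_nonneg k)]
        simp

/-- The expectation of `secondTerm`. -/
noncomputable def secondMean (wStar : Patch d) (σ b : ℝ) (w : Patch d) : Patch d :=
  (1 - ⟪w, wStar⟫ + b) • wStar - σ ^ 2 • w

/-- Sorts the fluctuation by degree in the noise; the constant `σ² ⟪e, w⟫` offsets the mean of the
quadratic term. -/
lemma inner_secondTerm_sub (wStar : Patch d) (σ b : ℝ) (w e g : Patch d) :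
    ⟪e, secondTerm wStar σ b w g - secondMean wStar σ b w⟫ =
      (1 - ⟪w, wStar⟫ + b) * σ * ⟪e, g⟫ + (-(σ * ⟪e, wStar⟫)) * ⟪w, g⟫ +
        (-σ ^ 2) * (⟪w, g⟫ * ⟪e, g⟫) + σ ^ 2 * ⟪e, w⟫ := by
  simp only [secondTerm, secondMean, inner_sub_right, inner_add_right, real_inner_smul_right]
  ring

lemma integral_add_four {Ω : Type*} [MeasurableSpace Ω] {μ : Measure Ω} {f₁ f₂ f₃ f₄ : Ω → ℝ}
    (h₁ : Integrable f₁ μ) (h₂ : Integrable f₂ μ) (h₃ : Integrable f₃ μ) (h₄ : Integrable f₄ μ) :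
    ∫ x, (f₁ x + f₂ x + f₃ x + f₄ x) ∂μ =
      ∫ x, f₁ x ∂μ + ∫ x, f₂ x ∂μ + ∫ x, f₃ x ∂μ + ∫ x, f₄ x ∂μ := by
  have h₁₂ : Integrable (fun x => f₁ x + f₂ x) μ := h₁.add h₂
  have h₁₃ : Integrable (fun x => f₁ x + f₂ x + f₃ x) μ := h₁₂.add h₃
  rw [integral_add h₁₃ h₄, integral_add h₁₂ h₃, integral_add h₁ h₂]

lemma memLp_inner_mul_inner (w e : Patch d) :
    MemLp (fun g => ⟪w, g⟫ * ⟪e, g⟫) 2 (stdGaussian (Patch d)) := by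
  have : ENNReal.HolderTriple 4 4 2 := ⟨by
    rw [← two_mul, show (4 : ℝ≥0∞) = 2 * 2 by norm_num, ENNReal.mul_inv (by norm_num) (by norm_num),
      ← mul_assoc, ENNReal.mul_inv_cancel (by norm_num) (by norm_num), one_mul]⟩
  exact (memLp_inner_stdGaussian e 4 (by norm_num)).mul'
    (memLp_inner_stdGaussian w 4 (by norm_num))

lemma memLp_inner_secondTerm_sub (wStar : Patch d) (σ b : ℝ) (w e : Patch d) :
    MemLp (fun g => ⟪e, secondTerm wStar σ b w g - secondMean wStar σ b w⟫) 2
      (stdGaussian (Patch d)) := by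
  simp_rw [inner_secondTerm_sub]
  exact ((((memLp_inner_stdGaussian e 2 (by norm_num)).const_mul _).add
    ((memLp_inner_stdGaussian w 2 (by norm_num)).const_mul _)).add
    ((memLp_inner_mul_inner w e).const_mul _)).add (memLp_const _)

lemma integral_inner_secondTerm_sub (wStar : Patch d) (σ b : ℝ) (w e : Patch d) :
    ∫ g, ⟪e, secondTerm wStar σ b w g - secondMean wStar σ b w⟫ ∂(stdGaussian (Patch d)) = 0 := by
  simp_rw [inner_secondTerm_sub]
  have i1 := ((memLp_inner_stdGaussian e 2 (by norm_num)).integrable (by norm_num)).const_mul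
    ((1 - ⟪w, wStar⟫ + b) * σ)
  have i2 := ((memLp_inner_stdGaussian w 2 (by norm_num)).integrable (by norm_num)).const_mul
    (-(σ * ⟪e, wStar⟫))
  have i3 := ((memLp_inner_mul_inner w e).integrable (by norm_num)).const_mul (-σ ^ 2)
  rw [integral_add_four i1 i2 i3 (integrable_const _), integral_const_mul,
    integral_const_mul, integral_const_mul,
    integral_inner_stdGaussian, integral_inner_stdGaussian, integral_inner_mul_inner_stdGaussian,
    real_inner_comm w e]
  simp

/-- The factor `⟪e, wStar⟫ ^ 2` is kept because over an orthonormal basis it sums to `1` rather than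
`d`. The last constant absorbs `3 · 192 + 6`, from two fourth moments and the centering. -/
lemma integral_inner_secondTerm_sub_sq_le (wStar : Patch d) (σ b : ℝ) {w e : Patch d}
    (hw : ‖w‖ = 1) (he : ‖e‖ = 1) :
    ∫ g, ⟪e, secondTerm wStar σ b w g - secondMean wStar σ b w⟫ ^ 2 ∂(stdGaussian (Patch d)) ≤
      3 * ((1 - ⟪w, wStar⟫ + b) ^ 2 * σ ^ 2) + 3 * σ ^ 2 * ⟪e, wStar⟫ ^ 2 + 600 * σ ^ 4 := by
  set ρ := 1 - ⟪w, wStar⟫ + b with hρ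
  have hμ : ⟪e, w⟫ ^ 2 ≤ 1 := by
    have h := abs_real_inner_le_norm e w
    rw [hw, he, mul_one] at h
    exact (sq_le_one_iff_abs_le_one _).mpr h
  have hpt : ∀ g, ⟪e, secondTerm wStar σ b w g - secondMean wStar σ b w⟫ ^ 2 ≤
      3 * (ρ ^ 2 * σ ^ 2) * ⟪e, g⟫ ^ 2 + 3 * σ ^ 2 * ⟪e, wStar⟫ ^ 2 * ⟪w, g⟫ ^ 2 +
        3 * σ ^ 4 * (⟪w, g⟫ ^ 4 + ⟪e, g⟫ ^ 4) + 6 * σ ^ 4 := by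
    intro g
    rw [inner_secondTerm_sub, ← hρ]
    generalize ⟪e, g⟫ = x
    generalize ⟪w, g⟫ = h
    generalize ⟪e, wStar⟫ = c
    generalize ⟪e, w⟫ = μ at hμ
    have hA : (h * x - μ) ^ 2 ≤ h ^ 4 + x ^ 4 + 2 := by
      nlinarith [sq_nonneg (h * x + μ), sq_nonneg (h ^ 2 - x ^ 2)]
    have hB : σ ^ 4 * (h * x - μ) ^ 2 ≤ σ ^ 4 * (h ^ 4 + x ^ 4 + 2) :=
      mul_le_mul_of_nonneg_left hA (by positivity)
    have hC : (ρ * σ * x + -(σ * c) * h + -σ ^ 2 * (h * x) + σ ^ 2 * μ) ^ 2 ≤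
        3 * ((ρ * σ * x) ^ 2 + (σ * c * h) ^ 2 + (σ ^ 2 * (h * x - μ)) ^ 2) := by
      nlinarith [sq_nonneg (ρ * σ * x + σ * c * h), sq_nonneg (ρ * σ * x + σ ^ 2 * (h * x - μ)),
        sq_nonneg (σ * c * h - σ ^ 2 * (h * x - μ))]
    nlinarith
  have j1 := ((memLp_inner_stdGaussian e 2 (by norm_num)).integrable_sq).const_mul
    (3 * (ρ ^ 2 * σ ^ 2))
  have j2 := ((memLp_inner_stdGaussian w 2 (by norm_num)).integrable_sq).const_mul
    (3 * σ ^ 2 * ⟪e, wStar⟫ ^ 2)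
  have hfour : ∀ u : Patch d, Integrable (fun g => ⟪u, g⟫ ^ 4) (stdGaussian (Patch d)) := by
    intro u
    have h := (memLp_inner_mul_inner u u).integrable_sq
    refine h.congr (Filter.Eventually.of_forall fun g => ?_)
    ring
  have hfour' : Integrable (fun g => ⟪w, g⟫ ^ 4 + ⟪e, g⟫ ^ 4) (stdGaussian (Patch d)) :=
    (hfour w).add (hfour e)
  have j3 := hfour'.const_mul (3 * σ ^ 4)
  have h := integral_mono (memLp_inner_secondTerm_sub wStar σ b w e).integrable_sq
    (((j1.add j2).add j3).add (integrable_const (6 * σ ^ 4))) hpt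
  have h' : ∫ g, (3 * (ρ ^ 2 * σ ^ 2) * ⟪e, g⟫ ^ 2 + 3 * σ ^ 2 * ⟪e, wStar⟫ ^ 2 * ⟪w, g⟫ ^ 2 +
        3 * σ ^ 4 * (⟪w, g⟫ ^ 4 + ⟪e, g⟫ ^ 4) + 6 * σ ^ 4) ∂(stdGaussian (Patch d)) =
      3 * (ρ ^ 2 * σ ^ 2) + 3 * σ ^ 2 * ⟪e, wStar⟫ ^ 2 +
        3 * σ ^ 4 * (∫ g, ⟪w, g⟫ ^ 4 ∂(stdGaussian (Patch d)) +
          ∫ g, ⟪e, g⟫ ^ 4 ∂(stdGaussian (Patch d))) + 6 * σ ^ 4 := by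
    rw [integral_add_four j1 j2 j3 (integrable_const _), integral_const_mul,
    integral_const_mul, integral_const_mul,
      integral_add (hfour w) (hfour e), integral_inner_sq_stdGaussian,
      integral_inner_sq_stdGaussian, hw, he]
    simp
  have k1 := integral_inner_pow_four_stdGaussian_le hw
  have k2 := integral_inner_pow_four_stdGaussian_le he
  have k3 : 3 * σ ^ 4 * (∫ g, ⟪w, g⟫ ^ 4 ∂(stdGaussian (Patch d)) +
      ∫ g, ⟪e, g⟫ ^ 4 ∂(stdGaussian (Patch d))) ≤ 3 * σ ^ 4 * 192 :=
    mul_le_mul_of_nonneg_left (by linarith) (by positivity)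
  have k4 : (0 : ℝ) ≤ σ ^ 4 := by positivity
  calc _ ≤ _ := h
    _ = _ := h'
    _ ≤ _ := by linarith

lemma measure_gradient_deviation_le (hk : 0 < k) (hm : 0 < m) {w wStar : Patch d} (hw : ‖w‖ = 1)
    (hw' : ‖wStar‖ = 1) {σ b : ℝ} (hb : 0 < b) (hbk : b ^ 2 * k = 1)
    (h1 : σ ^ 2 * k ≤ 1 / 10 ^ 10) (h2 : σ ^ 2 * d ≤ m / 10 ^ 10) :
    (Measure.pi fun _ : Fin m => latentMeasure k d)
      {s | ((1 - ⟪w, wStar⟫ + b) / 200) ^ 2 ≤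
        ‖average (fun a => secondTerm wStar σ b w (signalNoise a)) s -
          secondMean wStar σ b w‖ ^ 2} ≤ ENNReal.ofReal (1 / 10 ^ 4) := by
  have := isProbabilityMeasure_latentMeasure (d := d) hk
  have hkR : (1 : ℝ) ≤ k := by exact_mod_cast hk
  have hmR : (1 : ℝ) ≤ m := by exact_mod_cast hm
  set ρ := 1 - ⟪w, wStar⟫ + b with hρ
  have hρb : b ≤ ρ := by
    have h := (abs_le.mp (abs_real_inner_le_norm w wStar)).2
    rw [hw, hw', mul_one] at h
    linarith
  have hρ0 : 0 < ρ := hb.trans_le hρb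
  have hρk : 1 ≤ ρ ^ 2 * k := by
    rw [← hbk]
    exact mul_le_mul_of_nonneg_right (pow_le_pow_left₀ hb.le hρb 2) (by positivity)
  let F : Patch d → Patch d := fun g => secondTerm wStar σ b w g - secondMean wStar σ b w
  let e := EuclideanSpace.basisFun (Fin d) ℝ
  have hmp := measurePreserving_signalNoise (d := d) hk
  have hint : ∀ f : Patch d → ℝ, Measurable f →
      ∫ a, f (signalNoise a) ∂(latentMeasure k d) = ∫ g, f g ∂(stdGaussian (Patch d)) := by
    intro f hf
    rw [← hmp.map_eq, integral_map hmp.measurable.aemeasurable hf.aestronglyMeasurable]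
  have hFm : ∀ i, Measurable (fun g => ⟪e i, F g⟫) := by
    intro i
    simp only [F, secondTerm, secondMean]
    fun_prop
  have hsum : ∑ i, ∫ a, ⟪e i, F (signalNoise a)⟫ ^ 2 ∂(latentMeasure k d) ≤
      3 * (ρ ^ 2 * σ ^ 2) * d + 3 * σ ^ 2 + 600 * σ ^ 4 * d := by
    have hs : ∑ i, ⟪e i, wStar⟫ ^ 2 = 1 := by
      rw [e.sum_sq_inner_right, hw', one_pow]
    calc _ ≤ ∑ i, (3 * (ρ ^ 2 * σ ^ 2) + 3 * σ ^ 2 * ⟪e i, wStar⟫ ^ 2 + 600 * σ ^ 4) := by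
          refine Finset.sum_le_sum fun i _ => ?_
          rw [hint (fun g => ⟪e i, F g⟫ ^ 2) ((hFm i).pow_const 2)]
          exact integral_inner_secondTerm_sub_sq_le wStar σ b hw (e.norm_eq_one i)
      _ = _ := by
          rw [Finset.sum_add_distrib, Finset.sum_add_distrib,
            ← Finset.mul_sum _ fun i => ⟪e i, wStar⟫ ^ 2, hs]
          simp
          ring
  have b1 := measure_sum_average_sq_ge_le (m := m) (μ := latentMeasure k d)
    (f := fun i a => ⟪e i, F (signalNoise a)⟫)
    (fun i => (memLp_inner_secondTerm_sub wStar σ b w (e i)).comp_measurePreserving hmp)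
    (fun i => by
      rw [hint (fun g => ⟪e i, F g⟫) (hFm i)]
      exact integral_inner_secondTerm_sub wStar σ b w (e i)) (t := (ρ / 200) ^ 2)
    (by positivity) hsum
  have hav : ∀ s : Fin m → Latent k d, average (fun a => F (signalNoise a)) s =
      average (fun a => secondTerm wStar σ b w (signalNoise a)) s - secondMean wStar σ b w := by
    intro s
    have h := average_add_const hm (-secondMean wStar σ b w)
      (fun a : Latent k d => secondTerm wStar σ b w (signalNoise a)) s
    simp only [neg_add_eq_sub] at h
    exact h
  simp_rw [sum_average_inner_sq, hav] at b1
  refine b1.trans (ENNReal.ofReal_le_ofReal ?_)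
  rw [div_le_iff₀ (by positivity)]
  have a1 : ρ ^ 2 * (σ ^ 2 * d) ≤ ρ ^ 2 * (m / 10 ^ 10) :=
    mul_le_mul_of_nonneg_left h2 (by positivity)
  -- This is where the size of the bias enters: `ρ ≥ b` and `b² k = 1` turn smallness of `σ² k` into
  -- smallness of `σ²` relative to `ρ²`.
  have a2 : σ ^ 2 ≤ ρ ^ 2 / 10 ^ 10 := by
    have : σ ^ 2 * 1 ≤ σ ^ 2 * (ρ ^ 2 * k) := mul_le_mul_of_nonneg_left hρk (by positivity)
    have : ρ ^ 2 * (σ ^ 2 * k) ≤ ρ ^ 2 * (1 / 10 ^ 10) :=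
      mul_le_mul_of_nonneg_left h1 (by positivity)
    linarith
  have a3 : σ ^ 2 * (σ ^ 2 * d) ≤ ρ ^ 2 / 10 ^ 10 * (m / 10 ^ 10) :=
    mul_le_mul a2 h2 (by positivity) (by positivity)
  have a4 : ρ ^ 2 * 1 ≤ ρ ^ 2 * m := mul_le_mul_of_nonneg_left hmR (by positivity)
  nlinarith

lemma inner_second_weight_ge {w wStar z : Patch d} {σ b : ℝ} (hw : ‖w‖ = 1) (hw' : ‖wStar‖ = 1)
    (hb : 0 < b) (hσ : σ ^ 2 ≤ b / 1000)
    (hz : ‖z - secondMean wStar σ b w‖ ^ 2 < ((1 - ⟪w, wStar⟫ + b) / 200) ^ 2) :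
    49 / 50 ≤ ⟪NormedSpace.normalize (w + (1000 / b) • z), wStar⟫ := by
  set ρ := 1 - ⟪w, wStar⟫ + b with hρ
  have hρb : b ≤ ρ := by
    have h := (abs_le.mp (abs_real_inner_le_norm w wStar)).2
    rw [hw, hw', mul_one] at h
    linarith
  have hρ0 : 0 < ρ := hb.trans_le hρb
  have hz' := lt_of_pow_lt_pow_left₀ 2 (by positivity) hz
  -- Normalization ignores positive scaling. This factor makes the coefficient of `wStar` exactly
  -- `1`; the remainder is at most `1/1000` along `w` plus `1/200` from the deviation.
  have hc : 0 < b / (1000 * ρ) := by positivity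
  rw [← normalize_smul_of_pos hc]
  apply inner_normalize_ge_of_norm_sub_le hw'
  have hdec : (b / (1000 * ρ)) • (w + (1000 / b) • z) - wStar =
      (b / (1000 * ρ) - σ ^ 2 / ρ) • w + ρ⁻¹ • (z - secondMean wStar σ b w) := by
    rw [secondMean, ← hρ]
    have e1 : b / (1000 * ρ) * (1000 / b) = ρ⁻¹ := by field_simp
    have e2 : ρ⁻¹ * ρ = 1 := inv_mul_cancel₀ hρ0.ne'
    have e3 : ρ⁻¹ * σ ^ 2 = σ ^ 2 / ρ := by rw [inv_mul_eq_div]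
    rw [smul_add, smul_smul, e1, smul_sub, smul_sub, smul_smul, smul_smul, e2, e3, one_smul,
      sub_smul]
    abel
  rw [hdec]
  refine (norm_add_le _ _).trans ?_
  rw [norm_smul, norm_smul, hw, mul_one, Real.norm_eq_abs, Real.norm_of_nonneg (by positivity)]
  have t1 : ρ⁻¹ * ‖z - secondMean wStar σ b w‖ ≤ 1 / 200 := by
    rw [inv_mul_le_iff₀ hρ0]
    linarith
  have t2 : b / (1000 * ρ) ≤ 1 / 1000 := by
    rw [div_le_div_iff₀ (by positivity) (by norm_num)]
    linarith
  have t3 : σ ^ 2 / ρ ≤ 1 / 1000 := by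
    rw [div_le_div_iff₀ hρ0 (by norm_num)]
    linarith
  have t4 : 0 ≤ σ ^ 2 / ρ := by positivity
  have t5 : |b / (1000 * ρ) - σ ^ 2 / ρ| ≤ 1 / 1000 := by
    rw [abs_le]
    constructor <;> linarith
  linarith

end SecondStep

/-! ### Combining the two steps into a bound on the expected risk. -/

section ExpectedRisk

variable {k d m : ℕ}

/-- The weight after the first step. -/
noncomputable def firstWeight (wStar : Patch d) (σ : ℝ) (s : Fin m → Latent k d) : Patch d :=
  NormedSpace.normalize (average (firstTerm wStar σ) s)

lemma measurable_firstWeight (wStar : Patch d) (σ : ℝ) :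
    Measurable (firstWeight (k := k) (m := m) wStar σ) := by
  have h : Measurable fun s : Fin m → Latent k d => average (firstTerm wStar σ) s := by
    simp only [average, firstTerm]
    fun_prop
  exact h.norm.inv.smul h

/-- The first weight is a unit vector that correlates with the signal. -/
def FirstGood (wStar : Patch d) (σ : ℝ) (s : Fin m → Latent k d) : Prop :=
  2 / √k ≤ ⟪firstWeight wStar σ s, wStar⟫ ∧ ‖firstWeight wStar σ s‖ = 1

/-- A noise patch is active in the second step, or the average gradient is far from its mean. -/
def SecondBad (wStar : Patch d) (σ b : ℝ) (w : Patch d) (s : Fin m → Latent k d) : Prop :=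
  (∃ j i, b ≤ |σ * ⟪w, (s j).2 i⟫|) ∨
    ((1 - ⟪w, wStar⟫ + b) / 200) ^ 2 ≤
      ‖average (fun a => secondTerm wStar σ b w (signalNoise a)) s - secondMean wStar σ b w‖ ^ 2

lemma measurableSet_firstGood (wStar : Patch d) (σ : ℝ) :
    MeasurableSet {s : Fin m → Latent k d | FirstGood wStar σ s} := by
  have h := measurable_firstWeight (k := k) (m := m) wStar σ
  exact (measurableSet_le measurable_const (h.inner (𝕜 := ℝ) measurable_const)).inter
    (measurableSet_eq_fun h.norm measurable_const)

lemma measurableSet_secondBad (hk : 0 < k) (wStar : Patch d) (σ b : ℝ) :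
    MeasurableSet {q : (Fin m → Latent k d) × (Fin m → Latent k d) |
      SecondBad wStar σ b (firstWeight wStar σ q.1) q.2} := by
  have h : Measurable fun q : (Fin m → Latent k d) × (Fin m → Latent k d) =>
    firstWeight wStar σ q.1 := (measurable_firstWeight wStar σ).comp measurable_fst
  have hg : ∀ j, Measurable fun q : (Fin m → Latent k d) × (Fin m → Latent k d) =>
      signalNoise (q.2 j) := fun j =>
    (measurePreserving_signalNoise hk).measurable.comp ((measurable_pi_apply j).comp measurable_snd)
  have hpatch : ∀ j i, Measurable fun q : (Fin m → Latent k d) × (Fin m → Latent k d) =>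
      (q.2 j).2 i := fun j i => by fun_prop
  have h1 : MeasurableSet {q : (Fin m → Latent k d) × (Fin m → Latent k d) |
      ∃ j i, b ≤ |σ * ⟪firstWeight wStar σ q.1, (q.2 j).2 i⟫|} := by
    have h2 : {q : (Fin m → Latent k d) × (Fin m → Latent k d) |
      ∃ j i, b ≤ |σ * ⟪firstWeight wStar σ q.1, (q.2 j).2 i⟫|} =
      ⋃ j, ⋃ i, {q | b ≤ |σ * ⟪firstWeight wStar σ q.1, (q.2 j).2 i⟫|} := by
      ext q
      simp
    rw [h2]
    refine MeasurableSet.iUnion fun j => MeasurableSet.iUnion fun i => ?_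
    exact measurableSet_le measurable_const
      (continuous_abs.measurable.comp ((h.inner (hpatch j i)).const_mul σ))
  suffices h2 : MeasurableSet {q : (Fin m → Latent k d) × (Fin m → Latent k d) |
      ((1 - ⟪firstWeight wStar σ q.1, wStar⟫ + b) / 200) ^ 2 ≤
        ‖average (fun a => secondTerm wStar σ b (firstWeight wStar σ q.1) (signalNoise a)) q.2 -
          secondMean wStar σ b (firstWeight wStar σ q.1)‖ ^ 2} from h1.union h2
  have h3 : Measurable fun q : (Fin m → Latent k d) × (Fin m → Latent k d) =>
      1 - ⟪firstWeight wStar σ q.1, wStar⟫ + b :=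
    ((h.inner measurable_const).const_sub 1).add_const b
  refine measurableSet_le ((h3.div_const 200).pow_const 2) ((Measurable.sub ?_ ?_).norm.pow_const 2)
  · have h4 : Measurable fun q : (Fin m → Latent k d) × (Fin m → Latent k d) =>
        ∑ j, secondTerm wStar σ b (firstWeight wStar σ q.1) (signalNoise (q.2 j)) :=
      Finset.measurable_fun_sum _ fun j _ =>
        (h3.sub ((h.inner (hg j)).const_mul σ)).smul (((hg j).const_smul σ).const_add wStar)
    exact h4.const_smul (1 / (m : ℝ))
  · exact (h3.smul measurable_const).sub (h.const_smul (σ ^ 2))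

lemma measure_secondBad_le (hk : 0 < k) (hm : 0 < m) {w wStar : Patch d} (hw : ‖w‖ = 1)
    (hw' : ‖wStar‖ = 1) {σ b : ℝ} (hσ : 0 < σ) (hb : 0 < b) (hbk : b ^ 2 * k = 1)
    (h1 : σ ^ 2 * k ≤ 1 / 10 ^ 10) (h2 : σ ^ 2 * d ≤ m / 10 ^ 10)
    (h3 : m * (k * (4 * Real.exp (-(b / σ)))) ≤ 1 / 10 ^ 5) :
    (Measure.pi fun _ : Fin m => latentMeasure k d) {s | SecondBad wStar σ b w s} ≤
      ENNReal.ofReal (11 / 10 ^ 5) := by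
  have e1 := (measure_active_noise_le (m := m) hk hw (b := b) hσ).trans
    (ENNReal.ofReal_le_ofReal h3)
  have e2 := measure_gradient_deviation_le hk hm hw hw' hb hbk h1 h2
  refine (measure_union_le _ _).trans ((add_le_add e1 e2).trans ?_)
  rw [← ENNReal.ofReal_add (by norm_num) (by norm_num)]
  exact ENNReal.ofReal_le_ofReal (by norm_num)

/-- Fubini over the independent batches: once the first batch is fixed, the first weight is a
deterministic vector for the second. The second event is restricted to `FirstGood` because its bound
needs a unit weight. -/
lemma measure_bad_le (hk : 64 ≤ k) {n : ℕ} (hn : 0 < n / 2) {wStar : Patch d}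
    (hw' : ‖wStar‖ = 1) {σ b : ℝ} (hσ : 0 < σ) (hb : 0 < b) (hbk : b ^ 2 * k = 1)
    (h1 : σ ^ 2 * k ≤ 1 / 10 ^ 10) (h2 : σ ^ 2 * d ≤ (n / 2 : ℕ) / 10 ^ 10)
    (h3 : (n / 2 : ℕ) * (k * (4 * Real.exp (-(b / σ)))) ≤ 1 / 10 ^ 5) :
    (Measure.pi fun _ : Fin n => latentMeasure k d)
      {s | ¬ FirstGood wStar σ (batch s 0) ∨ (FirstGood wStar σ (batch s 0) ∧
        SecondBad wStar σ b (firstWeight wStar σ (batch s 0)) (batch s 1))} ≤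
      ENNReal.ofReal (2 / 10 ^ 4) := by
  have hk0 : 0 < k := by omega
  have := isProbabilityMeasure_latentMeasure (d := d) hk0
  set P : Measure (Fin (n / 2) → Latent k d) := Measure.pi fun _ => latentMeasure k d with hP
  have hG := measurableSet_firstGood (k := k) (m := n / 2) wStar σ
  have hB := measurableSet_secondBad (m := n / 2) hk0 wStar σ b
  let A₁ : Set ((Fin (n / 2) → Latent k d) × (Fin (n / 2) → Latent k d)) :=
    Prod.fst ⁻¹' {s | FirstGood wStar σ s}ᶜ
  let A₂ : Set ((Fin (n / 2) → Latent k d) × (Fin (n / 2) → Latent k d)) :=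
    (Prod.fst ⁻¹' {s | FirstGood wStar σ s}) ∩
      {q | SecondBad wStar σ b (firstWeight wStar σ q.1) q.2}
  have hA₁ : MeasurableSet A₁ := measurable_fst hG.compl
  have hA₂ : MeasurableSet A₂ := (measurable_fst hG).inter hB
  have m1 : (P.prod P) A₁ ≤ ENNReal.ofReal (1 / 10 ^ 5) := by
    rw [measurePreserving_fst.measure_preimage hG.compl.nullMeasurableSet]
    exact measure_first_bad_le hk hn hw' h1 h2
  have m2 : (P.prod P) A₂ ≤ ENNReal.ofReal (11 / 10 ^ 5) := by
    rw [Measure.prod_apply hA₂]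
    have hfib : ∀ s, P (Prod.mk s ⁻¹' A₂) ≤ ENNReal.ofReal (11 / 10 ^ 5) := by
      intro s
      by_cases hs : FirstGood wStar σ s
      · refine (measure_mono fun t ht => ht.2).trans
          (measure_secondBad_le hk0 hn hs.2 hw' hσ hb hbk h1 h2 h3)
      · have hempty : Prod.mk s ⁻¹' A₂ = ∅ :=
          Set.eq_empty_of_forall_notMem fun t ht => hs ht.1
        rw [hempty, measure_empty]
        exact zero_le
    refine (lintegral_mono hfib).trans ?_
    rw [lintegral_const, measure_univ, mul_one]
  have hpre : {s : Fin n → Latent k d | ¬ FirstGood wStar σ (batch s 0) ∨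
      (FirstGood wStar σ (batch s 0) ∧
        SecondBad wStar σ b (firstWeight wStar σ (batch s 0)) (batch s 1))} =
      (fun s => (batch s 0, batch s 1)) ⁻¹' (A₁ ∪ A₂) := rfl
  rw [hpre, (measurePreserving_batch (latentMeasure k d) n).measure_preimage
    (hA₁.union hA₂).nullMeasurableSet]
  refine (measure_union_le _ _).trans ((add_le_add m1 m2).trans ?_)
  rw [← ENNReal.ofReal_add (by norm_num) (by norm_num)]
  exact ENNReal.ofReal_le_ofReal (by norm_num)

/-- The step sizes of the two steps. -/
noncomputable def stepSize (k : ℕ) : Fin 2 → ℝ := ![1 / 2, 500 * √k]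

/-- The biases of the two steps. -/
noncomputable def bias (k : ℕ) : Fin 2 → ℝ := ![1 / √k, 0]

lemma stepSize_pos (hk : 0 < k) (t : Fin 2) : 0 < stepSize k t := by
  fin_cases t <;> simp [stepSize, hk]

lemma bias_nonneg (k : ℕ) (t : Fin 2) : 0 ≤ bias k t := by
  fin_cases t <;> simp [bias]

lemma output_cnnPGD (hW : IsProbabilityMeasure (Measure.dirac (0 : Param d)))
    (hW' : ∀ᵐ v ∂(Measure.dirac (0 : Param d)), v ∈ cnnParamSet d) (n : ℕ)
    (wStar : Patch d) (σ : ℝ) (s : Fin n → Latent k d) :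
    (cnnPGD k d (Measure.dirac 0) hW hW' (stepSize k) (bias k) (bias_nonneg k) n).output
      (fun j => sample wStar σ (s j)) 0 =
    cnn (projectedStep (500 * √k) 0 (WithLp.toLp 2 (firstWeight wStar σ (batch s 0), 1 / √k))
      (fun j => sample wStar σ (batch s 1 j))) := by
  rw [firstWeight, ← projectedStep_first]
  rfl

/-- Normalization bounds the weight on every sample, so the risk is at most `2²` plus a tiny
variance. This controls the contribution of the bad event. -/
lemma risk_output_le (hk : 0 < k) (hW : IsProbabilityMeasure (Measure.dirac (0 : Param d)))
    (hW' : ∀ᵐ v ∂(Measure.dirac (0 : Param d)), v ∈ cnnParamSet d) (n : ℕ)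
    {wStar : Patch d} (hw' : ‖wStar‖ = 1) {σ : ℝ} (h1 : σ ^ 2 * k ≤ 1 / 10 ^ 10)
    (s : Fin n → Latent k d) :
    risk ((cnnPGD k d (Measure.dirac 0) hW hW' (stepSize k) (bias k) (bias_nonneg k) n).output
      (fun j => sample wStar σ (s j)) 0) (dsd k d wStar σ) ≤ ENNReal.ofReal 5 := by
  rw [output_cnnPGD]
  refine (risk_linear_le hk _ wStar σ).trans (ENNReal.ofReal_le_ofReal ?_)
  set w := NormedSpace.normalize (_ : Patch d)
  have hw : ‖w‖ ≤ 1 := norm_normalize_le _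
  have h2 := abs_real_inner_le_norm w wStar
  rw [hw', mul_one] at h2
  have h3 := abs_le.mp (h2.trans hw)
  have h4 : ‖w‖ ^ 2 ≤ 1 := pow_le_one₀ (norm_nonneg _) hw
  have h5 : σ ^ 2 * k * ‖w‖ ^ 2 ≤ σ ^ 2 * k * 1 := mul_le_mul_of_nonneg_left h4 (by positivity)
  nlinarith

lemma risk_output_le_of_good (hk : 64 ≤ k)
    (hW : IsProbabilityMeasure (Measure.dirac (0 : Param d)))
    (hW' : ∀ᵐ v ∂(Measure.dirac (0 : Param d)), v ∈ cnnParamSet d) (n : ℕ)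
    {wStar : Patch d} (hw' : ‖wStar‖ = 1) {σ : ℝ} (h1 : σ ^ 2 * k ≤ 1 / 10 ^ 10)
    {s : Fin n → Latent k d} (hs : FirstGood wStar σ (batch s 0))
    (hs' : ¬ SecondBad wStar σ (1 / √k) (firstWeight wStar σ (batch s 0)) (batch s 1)) :
    risk ((cnnPGD k d (Measure.dirac 0) hW hW' (stepSize k) (bias k) (bias_nonneg k) n).output
      (fun j => sample wStar σ (s j)) 0) (dsd k d wStar σ) ≤ ENNReal.ofReal (1 / 1000) := by
  have hk0 : 0 < k := by omega
  have hkR : (64 : ℝ) ≤ k := by exact_mod_cast hk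
  have hsq : 0 < √(k : ℝ) := by positivity
  have hsq1 : 1 ≤ √(k : ℝ) := Real.le_sqrt_of_sq_le (by linarith)
  have hsq2 : √(k : ℝ) ^ 2 = k := Real.sq_sqrt (by positivity)
  simp only [SecondBad, not_or, not_exists, not_le] at hs'
  obtain ⟨hact, hdev⟩ := hs'
  rw [output_cnnPGD, projectedStep_second (by positivity)
    (by rw [mul_one_div]; exact hs.1) hact]
  refine (risk_linear_le hk0 _ wStar σ).trans (ENNReal.ofReal_le_ofReal ?_)
  -- The step size is chosen so that the update is `w + (1000 / b) z` with `b = 1 / √k`.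
  have hη : 2 * (500 * √(k : ℝ)) = 1000 / (1 / √k) := by
    rw [div_div_eq_mul_div]; ring
  rw [hη]
  have hσ : σ ^ 2 ≤ 1 / √k / 1000 := by
    have h5 : σ ^ 2 * √k ≤ σ ^ 2 * k :=
      mul_le_mul_of_nonneg_left (by nlinarith) (sq_nonneg σ)
    rw [div_div, le_div_iff₀ (by positivity)]
    nlinarith
  have h2 := inner_second_weight_ge hs.2 hw' (by positivity) hσ hdev
  set w := NormedSpace.normalize (_ : Patch d)
  have hw : ‖w‖ ≤ 1 := norm_normalize_le _
  have h3 := abs_real_inner_le_norm w wStar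
  rw [hw', mul_one] at h3
  have h3' := abs_le.mp (h3.trans hw)
  have h4 : ‖w‖ ^ 2 ≤ 1 := pow_le_one₀ (norm_nonneg _) hw
  have h5 : σ ^ 2 * k * ‖w‖ ^ 2 ≤ σ ^ 2 * k * 1 := mul_le_mul_of_nonneg_left h4 (by positivity)
  nlinarith

lemma expectedRisk_cnnPGD_le (hk : 64 ≤ k)
    (hW : IsProbabilityMeasure (Measure.dirac (0 : Param d)))
    (hW' : ∀ᵐ v ∂(Measure.dirac (0 : Param d)), v ∈ cnnParamSet d) {n : ℕ} (hn : 0 < n / 2)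
    {wStar : Patch d} (hw' : ‖wStar‖ = 1) {σ : ℝ} (hσ : 0 < σ)
    (h1 : σ ^ 2 * k ≤ 1 / 10 ^ 10) (h2 : σ ^ 2 * d ≤ (n / 2 : ℕ) / 10 ^ 10)
    (h3 : (n / 2 : ℕ) * (k * (4 * Real.exp (-(1 / √k / σ)))) ≤ 1 / 10 ^ 5) :
    expectedRisk (cnnPGD k d (Measure.dirac 0) hW hW' (stepSize k) (bias k) (bias_nonneg k) n)
      (dsd k d wStar σ) ≤ ENNReal.ofReal (1 / 400) := by
  have hk0 : 0 < k := by omega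
  have hkR : (0 : ℝ) < k := by exact_mod_cast hk0
  have := isProbabilityMeasure_latentMeasure (d := d) hk0
  set A := cnnPGD k d (Measure.dirac 0) hW hW' (stepSize k) (bias k) (bias_nonneg k) n with hA
  have hinit : ∀ S, ∫⁻ w₀, risk (A.output S w₀) (dsd k d wStar σ) ∂A.init =
      risk (A.output S 0) (dsd k d wStar σ) := fun S => by
    change ∫⁻ w₀, risk (A.output S w₀) (dsd k d wStar σ) ∂(Measure.dirac 0) = _
    rw [lintegral_dirac]
  rw [expectedRisk]
  simp_rw [hinit]
  rw [← map_pi_sample hk0]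
  refine (lintegral_map_le _ _).trans ?_
  set μ := Measure.pi fun _ : Fin n => latentMeasure k d
  set T : Set (Fin n → Latent k d) := {s | ¬ FirstGood wStar σ (batch s 0) ∨
    (FirstGood wStar σ (batch s 0) ∧
      SecondBad wStar σ (1 / √k) (firstWeight wStar σ (batch s 0)) (batch s 1))} with hT
  have hμT : μ T ≤ ENNReal.ofReal (2 / 10 ^ 4) := by
    refine measure_bad_le hk hn hw' hσ (by positivity) ?_ h1 h2 h3
    rw [div_pow, Real.sq_sqrt hkR.le, one_pow, one_div, inv_mul_cancel₀ hkR.ne']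
  -- Using the measurable hull of `T`, which has the same measure, avoids proving `T` measurable.
  have hpt : ∀ s, risk (A.output (fun j => sample wStar σ (s j)) 0) (dsd k d wStar σ) ≤
      ENNReal.ofReal (1 / 1000) +
        (toMeasurable μ T).indicator (fun _ => ENNReal.ofReal 5) s := by
    intro s
    by_cases hs : s ∈ T
    · rw [Set.indicator_of_mem (subset_toMeasurable μ T hs)]
      exact (risk_output_le hk0 hW hW' n hw' h1 s).trans le_add_self
    · simp only [hT, Set.mem_ofPred_eq, not_or, not_not, not_and] at hs
      exact (risk_output_le_of_good hk hW hW' n hw' h1 hs.1 (hs.2 hs.1)).trans le_self_add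
  refine (lintegral_mono hpt).trans ?_
  rw [lintegral_add_left measurable_const, lintegral_const, measure_univ, mul_one,
    lintegral_indicator_const (measurableSet_toMeasurable μ T), measure_toMeasurable]
  refine (add_le_add le_rfl (mul_le_mul_right hμT _)).trans ?_
  rw [← ENNReal.ofReal_mul (by norm_num), ← ENNReal.ofReal_add (by norm_num) (by norm_num)]
  exact ENNReal.ofReal_le_ofReal (by norm_num)

end ExpectedRisk

/-! ### Choice of the sample size. -/

section SampleComplexity

lemma exists_sample_size {k d : ℕ} (hk : Real.exp 100 ≤ k) (hd : Real.exp 100 ≤ d) {σ : ℝ}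
    (hσ : 0 < σ)
    (hσ' : σ ≤ 1 / (100 * √((k : ℝ) * Real.log ((k : ℝ) * d) ^ 3))) :
    ∃ n : ℕ, (n : ℝ) ≤ max (10 ^ 11 * (σ ^ 2 * ((k : ℝ) + d) * Real.log ((k : ℝ) * d))) 10 ∧
      0 < n / 2 ∧ σ ^ 2 * k ≤ 1 / 10 ^ 10 ∧ σ ^ 2 * d ≤ (n / 2 : ℕ) / 10 ^ 10 ∧
      (n / 2 : ℕ) * (k * (4 * Real.exp (-(1 / √k / σ)))) ≤ 1 / 10 ^ 5 := by
  have he : (10 : ℝ) ^ 30 ≤ Real.exp 100 := by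
    have h2 : (2 : ℝ) ≤ Real.exp 1 := by linarith [Real.exp_one_gt_d9]
    have h3 : Real.exp 100 = Real.exp 1 ^ 100 := by
      rw [← Real.exp_nat_mul]; norm_num
    rw [h3]
    calc (10 : ℝ) ^ 30 ≤ 2 ^ 100 := by norm_num
      _ ≤ _ := pow_le_pow_left₀ (by norm_num) h2 100
  have hk1 : (1 : ℝ) ≤ k := by linarith
  have hd1 : (1 : ℝ) ≤ d := by linarith
  have hkd : Real.exp 100 ≤ (k : ℝ) * d := by nlinarith
  have hkd0 : (0 : ℝ) < (k : ℝ) * d := by positivity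
  set L := Real.log ((k : ℝ) * d) with hL
  have hL100 : 100 ≤ L := by
    rw [hL, Real.le_log_iff_exp_le hkd0]
    exact hkd
  have hexpL : Real.exp L = (k : ℝ) * d := Real.exp_log hkd0
  have hsqrt : √((k : ℝ) * L ^ 3) ^ 2 = k * L ^ 3 := Real.sq_sqrt (by positivity)
  have hsqrt0 : 0 < √((k : ℝ) * L ^ 3) := Real.sqrt_pos.mpr (by positivity)
  have hmul : σ * (100 * √((k : ℝ) * L ^ 3)) ≤ 1 := by
    rwa [le_div_iff₀ (by positivity)] at hσ'
  have hsq : σ ^ 2 * (k * L ^ 3) ≤ 1 / 10 ^ 4 := by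
    have h : (σ * (100 * √((k : ℝ) * L ^ 3))) ^ 2 ≤ 1 := pow_le_one₀ (by positivity) hmul
    rw [mul_pow, mul_pow, hsqrt] at h
    linarith
  have hL3 : 10 ^ 6 ≤ L ^ 3 := by
    calc (10 : ℝ) ^ 6 = 100 ^ 3 := by norm_num
      _ ≤ L ^ 3 := pow_le_pow_left₀ (by norm_num) hL100 3
  have hLL3 : L ≤ L ^ 3 := by nlinarith [sq_nonneg L]
  have hσk : 0 ≤ σ ^ 2 * k := by positivity
  have c1 : σ ^ 2 * k ≤ 1 / 10 ^ 10 := by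
    have h : σ ^ 2 * k * 10 ^ 6 ≤ σ ^ 2 * k * L ^ 3 := mul_le_mul_of_nonneg_left hL3 hσk
    linarith
  have c1' : σ ^ 2 * k * L ≤ 1 / 10 ^ 4 := by
    have h : σ ^ 2 * k * L ≤ σ ^ 2 * k * L ^ 3 := mul_le_mul_of_nonneg_left hLL3 hσk
    linarith
  set X := 10 ^ 11 * (σ ^ 2 * ((k : ℝ) + d) * L) with hX
  have hX0 : 0 ≤ X := by positivity
  have hXd : 10 ^ 11 * (σ ^ 2 * d) ≤ X := by
    have h : σ ^ 2 * d * 1 ≤ σ ^ 2 * ((k : ℝ) + d) * L :=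
      mul_le_mul (mul_le_mul_of_nonneg_left (by linarith) (sq_nonneg σ)) (by linarith)
        (by norm_num) (by positivity)
    linarith
  -- An upper bound on the sample size is needed as well, since the union bound over noise patches
  -- grows with it.
  have hXle : X ≤ 10 ^ 8 * d := by
    have h1 : (k : ℝ) + d ≤ 2 * (k * d) := by nlinarith
    have h2 : σ ^ 2 * ((k : ℝ) + d) * L ≤ 2 * d * (1 / 10 ^ 4) := by
      calc σ ^ 2 * ((k : ℝ) + d) * L ≤ σ ^ 2 * (2 * (k * d)) * L := by gcongr
        _ = 2 * d * (σ ^ 2 * k * L) := by ring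
        _ ≤ 2 * d * (1 / 10 ^ 4) := by gcongr
    linarith
  -- With `M ≥ 10`, rounding down and halving still leaves at least `(M - 2) / 2 ≥ 2M / 5` samples
  -- per batch, so `10^11` in `X` leaves room for the required `10^10`.
  set M := max X 10 with hM
  have hM10 : 10 ≤ M := le_max_right _ _
  have hn1 : (⌊M⌋₊ : ℝ) ≤ M := Nat.floor_le (by linarith)
  have hn2 : M < ⌊M⌋₊ + 1 := Nat.lt_floor_add_one M
  have hn10 : 10 ≤ ⌊M⌋₊ := Nat.le_floor (by exact_mod_cast hM10)
  have hm1 : ((⌊M⌋₊ / 2 : ℕ) : ℝ) * 2 ≤ ⌊M⌋₊ := by exact_mod_cast Nat.div_mul_le_self _ 2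
  have hm2 : (⌊M⌋₊ : ℝ) ≤ ((⌊M⌋₊ / 2 : ℕ) : ℝ) * 2 + 1 := by
    have : ⌊M⌋₊ ≤ ⌊M⌋₊ / 2 * 2 + 1 := by omega
    exact_mod_cast this
  refine ⟨⌊M⌋₊, hn1, by omega, c1, ?_, ?_⟩
  · have : X ≤ M := le_max_left _ _
    linarith
  -- The bound on `σ` makes the exponent at least `2L`, so each tail is at most `(k d)⁻²`. Against
  -- about `d · k` noise responses, a factor `1 / (k d)` remains to beat the constants.
  · have hexp : Real.exp (-(1 / √k / σ)) ≤ Real.exp (-L) * Real.exp (-L) := by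
      rw [← Real.exp_add]
      apply Real.exp_le_exp.mpr
      have h1 : √(k : ℝ) * L ≤ √((k : ℝ) * L ^ 3) := by
        apply Real.le_sqrt_of_sq_le
        rw [mul_pow, Real.sq_sqrt (by positivity)]
        exact mul_le_mul_of_nonneg_left (by nlinarith [sq_nonneg L]) (by positivity)
      have h2 : 2 * L ≤ 1 / √k / σ := by
        have hsk : 0 < √(k : ℝ) := Real.sqrt_pos.mpr (by linarith)
        rw [div_div, le_div_iff₀ (by positivity)]
        have h3 : σ * (√(k : ℝ) * L) ≤ σ * √((k : ℝ) * L ^ 3) :=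
          mul_le_mul_of_nonneg_left h1 hσ.le
        nlinarith [mul_pos hσ hsqrt0]
      linarith
    have hE : Real.exp (-L) = 1 / (k * d) := by
      rw [Real.exp_neg, hexpL, one_div]
    rw [hE] at hexp
    have hMle : M ≤ 10 ^ 9 * d := max_le (by linarith) (by linarith)
    have hm3 : ((⌊M⌋₊ / 2 : ℕ) : ℝ) ≤ 10 ^ 9 * d := by linarith
    calc ((⌊M⌋₊ / 2 : ℕ) : ℝ) * (k * (4 * Real.exp (-(1 / √k / σ))))
        ≤ (10 ^ 9 * d) * (k * (4 * (1 / (k * d) * (1 / (k * d))))) := by gcongr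
      _ = 4 * 10 ^ 9 / (k * d) := by field_simp
      _ ≤ 1 / 10 ^ 5 := by
        rw [div_le_div_iff₀ hkd0 (by norm_num)]
        linarith

lemma sampleComplexity_le {X G : Type*} [MeasurableSpace X] [MeasurableSpace G]
    {A : ∀ n, IterativeAlgorithm X G n} {P : Measure (X × ℝ)} {δ : ℝ} {n : ℕ}
    (h : expectedRisk (A n) P ≤ ENNReal.ofReal δ) : sampleComplexity A P δ ≤ n :=
  iInf₂_le n h

end SampleComplexity
end DSD

theorem mainTheorem4 :
    ∃ C : ℝ, 0 < C ∧ ∃ K₀ : ℕ, ∀ k d : ℕ, 0 < k → 0 < d →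
      ∃ (W : Measure (DSD.Param d)) (hW : IsProbabilityMeasure W)
        (hW' : ∀ᵐ v ∂W, v ∈ DSD.cnnParamSet d) (η b : Fin 2 → ℝ) (hb : ∀ t, 0 ≤ b t),
        (∀ t, 0 < η t) ∧
        (∀ n : ℕ, DSD.IsEquivariant (DSD.cnnPGD k d W hW hW' η b hb n)
          (DSD.cnnGroup k d : Set (DSD.Input k d ≃ₗᵢ[ℝ] DSD.Input k d))) ∧
        (K₀ ≤ k → K₀ ≤ d →
          ∀ (σ : ℝ) (wStar : DSD.Patch d), 0 < σ →
            σ ≤ 1 / (100 * √((k : ℝ) * Real.log ((k : ℝ) * d) ^ 3)) → ‖wStar‖ = 1 →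
            ((DSD.sampleComplexity (DSD.cnnPGD k d W hW hW' η b hb)
                (DSD.dsd k d wStar σ) (1 / 400) : ℕ∞) : ℝ≥0∞) ≤
              ENNReal.ofReal
                (max (C * (σ ^ 2 * ((k : ℝ) + d) * Real.log ((k : ℝ) * d))) 10)) := by
  -- The `64` gives `√k ≥ 8` for the first step; `exp 100` gives `log (k d) ≥ 100` and `k d ≥
  -- 10^30`.
  refine ⟨10 ^ 11, by norm_num, max 64 ⌈Real.exp 100⌉₊, fun k d hk _ => ?_⟩
  have hW' : ∀ᵐ v ∂(Measure.dirac (0 : DSD.Param d)), v ∈ DSD.cnnParamSet d := by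
    rw [ae_dirac_eq]
    exact le_refl (0 : ℝ)
  refine ⟨Measure.dirac 0, inferInstance, hW', DSD.stepSize k, DSD.bias k, DSD.bias_nonneg k,
    DSD.stepSize_pos hk, fun n => DSD.isEquivariant_cnnPGD_dirac _ _ _ _ _ n, ?_⟩
  intro hKk hKd σ wStar hσ hσ' hw'
  have hk' : Real.exp 100 ≤ k := Nat.ceil_le.mp ((le_max_right _ _).trans hKk)
  have hd' : Real.exp 100 ≤ d := Nat.ceil_le.mp ((le_max_right _ _).trans hKd)
  obtain ⟨n, hn, hn2, h1, h2, h3⟩ := DSD.exists_sample_size hk' hd' hσ hσ'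
  have h := DSD.sampleComplexity_le (DSD.expectedRisk_cnnPGD_le ((le_max_left _ _).trans hKk)
    inferInstance hW' hn2 hw' hσ h1 h2 h3)
  calc ((DSD.sampleComplexity _ (DSD.dsd k d wStar σ) (1 / 400) : ℕ∞) : ℝ≥0∞)
      ≤ ((n : ℕ∞) : ℝ≥0∞) := ENat.toENNReal_le.mpr h
    _ = ENNReal.ofReal n := by rw [ENat.toENNReal_coe, ENNReal.ofReal_natCast]
    _ ≤ _ := ENNReal.ofReal_le_ofReal hn
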